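/- Let $b,\sigma:[0,\infty[\,\to\mathbb R$ be locally Lipschitz continuous with $\sigma(x)>0$ for all $x>0$, and let $r$ be continuous and bounded on $[0,\infty[$ with $r\ge r_0$ for some constant $r_0>0$. Set $$p'(x)=\exp\Bigl(-2\int_1^x\frac{b(s)}{\sigma^2(s)}\,ds\Bigr),\qquad m(dx)=\frac{2}{\sigma^2(x)p'(x)}\,dx ,$$ and suppose that both boundary points $0$ and $\infty$ of the diffusion $$dX_t=b(X_t)\,dt+\sigma(X_t)\,dW_t,\qquad X_0=x>0,$$ are inaccessible, that is, $\int_0^1 m(]x,1[)\,p'(x)\,dx=\int_1^\infty m(]1,x[)\,p'(x)\,dx=\infty$. The processes $X$ (one for each starting point $x>0$, with continuous paths in $]0,\infty[$) are understood as solutions of the martingale problem of $\frac12\sigma^2f''+bf'$ with test functions $f\in C^2_c(]0,\infty[)$. Let $\varphi$ and $\psi$ be strictly positive $C^2$ solutions of $\frac12\sigma^2w''+bw'-rw=0$ on $]0,\infty[$ with $\varphi'<0$ and $\psi'>0$, and put $$C=\varphi(1)\psi'(1)-\varphi'(1)\psi(1),\qquad \Psi=\frac{2\psi}{C\sigma^2p'}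 .$$ Let $\Theta:\,]0,\infty[\,\to\mathbb R$ be continuous, and let $\xi\in\,]0,\infty[$ be such that $\Theta/r$ is strictly increasing on $]0,\xi[$ and strictly decreasing on $]\xi,\infty[$. Suppose that, with $\Lambda_t=\int_0^t r(X_s)\,ds$, $$\mathbb E_x\Bigl[\int_0^\infty e^{-\Lambda_t}|\Theta(X_t)|\,dt\Bigr]<\infty\quad\text{for all }x>0,$$ and define $$R_\Theta(x)=\mathbb E_x\Bigl[\int_0^\infty e^{-\Lambda_t}\Theta(X_t)\,dt\Bigr],\qquad Q_\Theta(x)=\int_0^x\Theta(s)\Psi(s)\,ds-\frac{\Theta(x)}{r(x)}\,\frac{\psi'(x)}{Cp'(x)} .$$ Then $R_\Theta$ and $R'_\Theta/\psi'$ are differentiable on $]0,\infty[$, the integral in $Q_\Theta(x)$ converges absolutely for every $x>0$, and the following hold. (i) There is a unique $\underline x\in\,]\xi,\infty]$ such that $$\frac{d}{dx}\frac{R'_\Theta(x)}{\psi'(x)}\ \begin{cases}<0&\text{for all }x\in\,]0,\underline x[,\\>0&\text{for all }x\in\,]\underline x,\infty[,\end{cases}$$ where $]\infty,\infty[\,=\emptyset$.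 Moreover, $\lim_{x\uparrow\infty}R'_\Theta(x)/\psi'(x)=0$. (ii) The limit $\lim_{x\uparrow\infty}Q_\Theta(x)$ exists in $[-\infty,\infty]$, and $\underline x<\infty$ if and only if this limit is strictly positive. The limits of $\Theta/r$ at $0$ and at $\infty$ exist in $[-\infty,\infty]$, and $\underline x<\infty$ holds in particular if $$\lim_{x\uparrow\infty}\frac{\Theta(x)}{r(x)}=-\infty\quad\text{or}\quad\lim_{x\downarrow0}\frac{\Theta(x)}{r(x)}>\lim_{x\uparrow\infty}\frac{\Theta(x)}{r(x)} .$$ (iii) If $\underline x<\infty$, then $\lim_{x\downarrow0}R'_\Theta(x)/\psi'(x)$ exists in $[-\infty,\infty]$, and the point $$\overline x=\inf\Bigl\{s>0\ \Big|\ \frac{R'_\Theta(s)}{\psi'(s)}>\lim_{x\downarrow0}\frac{R'_\Theta(x)}{\psi'(x)}\Bigr\}\qquad(\inf\emptyset=\infty)$$ satisfies $\overline x>\underline x$, $$\overline x=\infty\iff\lim_{x\downarrow0}\frac{R'_\Theta(x)}{\psi'(x)}\ge0,$$ and $$\lim_{x\downarrow0}\frac{\Theta(x)}{r(x)}=-\infty\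 \Longrightarrow\ \lim_{x\downarrow0}\frac{R'_\Theta(x)}{\psi'(x)}=\infty\ \Longrightarrow\ \overline x=\infty .$$ -/

import Mathlib

open MeasureTheory ProbabilityTheory Filter Topology Set
open scoped NNReal ENNReal

namespace LinearDiffusion

noncomputable section

/-- The second-order part `½ σ² w'' + b w'` of the operator, i.e. the generator of the diffusion
`dX = b(X) dt + σ(X) dW`. -/
def generator (b σ w : ℝ → ℝ) (x : ℝ) : ℝ :=
  1 / 2 * σ x ^ 2 * deriv (deriv w) x + b x * deriv w x

/-- The operator `𝓛 w = ½ σ² w'' + b w' - r w`. -/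
def discountedGenerator (b σ r w : ℝ → ℝ) (x : ℝ) : ℝ :=
  generator b σ w x - r x * w x

/-- The derivative `p'` of the scale function `p` (normalised by `p 1 = 0`, `p' 1 = 1`). -/
def scaleDeriv (b σ : ℝ → ℝ) (x : ℝ) : ℝ :=
  Real.exp (-2 * ∫ s in (1 : ℝ)..x, b s / σ s ^ 2)

/-- The density `2 / (σ² p')` of the speed measure `m`. -/
def speedDensity (b σ : ℝ → ℝ) (x : ℝ) : ℝ :=
  2 / (σ x ^ 2 * scaleDeriv b σ x)

/-- The boundary point `0` is inaccessible (neither regular nor exit):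
`∫₀¹ m(]x, 1[) p'(x) dx = ∞`. -/
def ZeroInaccessible (b σ : ℝ → ℝ) : Prop :=
  ∫⁻ x in Ioo (0 : ℝ) 1,
    ENNReal.ofReal (scaleDeriv b σ x * ∫ y in x..(1 : ℝ), speedDensity b σ y) = ⊤

/-- The boundary point `∞` is inaccessible (neither regular nor exit):
`∫₁^∞ m(]1, x[) p'(x) dx = ∞`. -/
def InftyInaccessible (b σ : ℝ → ℝ) : Prop :=
  ∫⁻ x in Ioi (1 : ℝ),
    ENNReal.ofReal (scaleDeriv b σ x * ∫ y in (1 : ℝ)..x, speedDensity b σ y) = ⊤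

/-- `w` is a strictly positive `C²` solution of `𝓛 w = 0` on `]0, ∞[`. -/
structure IsPositiveSolution (b σ r w : ℝ → ℝ) : Prop where
  contDiffOn : ContDiffOn ℝ 2 w (Ioi 0)
  ode : ∀ x, 0 < x → discountedGenerator b σ r w x = 0
  pos : ∀ x, 0 < x → 0 < w x

/-- The strictly decreasing fundamental solution `φ`. -/
structure IsDecreasingSolution (b σ r φ : ℝ → ℝ) : Prop
    extends IsPositiveSolution b σ r φ where
  deriv_neg : ∀ x, 0 < x → deriv φ x < 0

/-- The strictly increasing fundamental solution `ψ`. -/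
structure IsIncreasingSolution (b σ r ψ : ℝ → ℝ) : Prop
    extends IsPositiveSolution b σ r ψ where
  deriv_pos : ∀ x, 0 < x → 0 < deriv ψ x

/-- The constant `C = φ(1) ψ'(1) - φ'(1) ψ(1)`. -/
def wronskianConst (φ ψ : ℝ → ℝ) : ℝ :=
  φ 1 * deriv ψ 1 - deriv φ 1 * ψ 1

/-- The function `Ψ = 2 ψ / (C σ² p')`. -/
def bigPsi (b σ φ ψ : ℝ → ℝ) (x : ℝ) : ℝ :=
  2 * ψ x / (wronskianConst φ ψ * σ x ^ 2 * scaleDeriv b σ x)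

/-- The function `Q_F(x) = ∫₀ˣ F Ψ ds - (F(x) / r(x)) ψ'(x) / (C p'(x))`. -/
def Qfun (b σ r φ ψ F : ℝ → ℝ) (x : ℝ) : ℝ :=
  (∫ s in Ioc 0 x, F s * bigPsi b σ φ ψ s) -
    F x / r x * (deriv ψ x / (wronskianConst φ ψ * scaleDeriv b σ x))

variable {Ω : Type*} [mΩ : MeasurableSpace Ω]

/-- `X` is a continuous adapted `]0, ∞[`-valued process started at `x` that solves
`dX = b(X) dt + σ(X) dW`, in the sense of the martingale problem for the generator. -/
structure IsDiffusion (b σ : ℝ → ℝ) (P : Measure Ω) (ℱ : Filtration ℝ≥0 mΩ) (x : ℝ)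
    (X : ℝ≥0 → Ω → ℝ) : Prop where
  adapted : StronglyAdapted ℱ X
  start : ∀ ω, X 0 ω = x
  pos : ∀ t ω, 0 < X t ω
  continuous : ∀ ω, Continuous fun t => X t ω
  martingale : ∀ f : ℝ → ℝ, ContDiff ℝ 2 f → HasCompactSupport f → tsupport f ⊆ Ioi 0 →
    Martingale
      (fun (t : ℝ≥0) ω =>
        f (X t ω) - ∫ s in (0 : ℝ)..(t : ℝ), generator b σ f (X s.toNNReal ω)) ℱ P

/-- The discounting exponent `Λ_t = ∫₀ᵗ r(X_s) ds` along the path `ω`. -/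
def discount (r : ℝ → ℝ) (X : ℝ≥0 → Ω → ℝ) (t : ℝ) (ω : Ω) : ℝ :=
  ∫ s in (0 : ℝ)..t, r (X s.toNNReal ω)

/-- `E[∫₀^∞ e^{-Λ_t} |F(X_t)| dt] < ∞`. -/
def FiniteDiscountedIntegral (r : ℝ → ℝ) (P : Measure Ω) (X : ℝ≥0 → Ω → ℝ) (F : ℝ → ℝ) : Prop :=
  ∫⁻ ω, (∫⁻ t in Ioi (0 : ℝ),
    ENNReal.ofReal (Real.exp (-discount r X t ω) * |F (X t.toNNReal ω)|)) ∂P < ⊤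

/-- The function `R_F(x) = E[∫₀^∞ e^{-Λ_t} F(X_t) dt]`, where `X = X x` is the diffusion started
at `x`. -/
def resolvent (r : ℝ → ℝ) (P : Measure Ω) (X : ℝ → ℝ≥0 → Ω → ℝ) (F : ℝ → ℝ) (x : ℝ) : ℝ :=
  ∫ ω, (∫ t in Ioi (0 : ℝ),
    Real.exp (-discount r (X x) t ω) * F (X x t.toNNReal ω)) ∂P

/-- The function `R'_F / ψ'`. -/
def derivRatio (r : ℝ → ℝ) (P : Measure Ω) (X : ℝ → ℝ≥0 → Ω → ℝ) (ψ F : ℝ → ℝ) (x : ℝ) : ℝ :=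
  deriv (resolvent r P X F) x / deriv ψ x

/-- `xl ∈ ]ξ, ∞]`, `g' < 0` on `]0, xl[` and `g' > 0` on `]xl, ∞[`. -/
def IsTurningPoint (ξ : ℝ) (g : ℝ → ℝ) (xl : EReal) : Prop :=
  (ξ : EReal) < xl ∧
    (∀ x : ℝ, 0 < x → (x : EReal) < xl → deriv g x < 0) ∧
    (∀ x : ℝ, xl < (x : EReal) → 0 < deriv g x)

/-- `inf {s > 0 | g(s) > L}` in `[-∞, ∞]`, with `inf ∅ = ∞`. -/
def upperPoint (g : ℝ → ℝ) (L : EReal) : EReal :=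
  sInf ((fun s : ℝ => (s : EReal)) '' {s : ℝ | 0 < s ∧ L < (g s : EReal)})

end

end LinearDiffusion

namespace LinearDiffusion

/-! ### Calculus on the half line -/

/-! The probabilistic object is first replaced by an explicit one. With `Φ = 2φ/(Cσ²p')`, the claim
is that `R_Θ(x) = φ(x) ∫₀ˣ ΘΨ + ψ(x) ∫ₓ^∞ ΘΦ`, that is, the discounted occupation measure of the
diffusion started at `x` has the Green kernel as density (`occupationMeasure_eq`). For continuous `0
≤ F ≤ M r` the Green function `u` of `F` satisfies `𝓛u = -F` and `u ≤ M`. Inaccessibility forces `φ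
→ ∞` at `0` and `ψ → ∞` at `∞`, so `u - ε(φ + ψ)` is positive at most on a compact set. A smooth
convex approximation of its positive part is an admissible test function `f` with `𝓛f ≥ -F`, and
Dynkin's formula `∫ 𝓛f dμ = -f(x)` for the occupation measure `μ` yields `u(x) ≤ ∫ F dμ`. The same
bound for `M r - F` is the reverse inequality, because both `μ` and the Green kernel integrate `r`
to `1`. Equality of the two measures then covers the unbounded `Θ`.

The rest is calculus. The Wronskian identity turns `(R'/ψ')'` into a positive factor times `Q`
(`hasDerivAt_greenDeriv_div`). Since `J = ψ'/(Cp')` satisfies `J' = rΨ` and vanishes at `0`, one has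
`Q(x) = ∫₀ˣ (Θ/r(s) - Θ/r(x)) r(s)Ψ(s) ds`. Hence `Q < 0` while `Θ/r` increases and `Q` is strictly
increasing once `Θ/r` decreases: there is at most one sign change, located after `ξ` and decided by
the limit of `Q` at `∞`.

Finally `R'/ψ'` is eventually monotone, `ψ → ∞` and `R/ψ → 0`, so a converse of l'Hôpital's rule
gives the limit `0` of `R'/ψ'`. If `x̲ < ∞`, the ratio decreases and then increases to `0`, so it is
negative from `x̲` on and can exceed its limit at `0` only if that limit is negative. -/

theorem sub_le_sub_of_hasDerivAt {f g f' g' : ℝ → ℝ} {a b : ℝ} (hab : a ≤ b)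
    (hf : ∀ x ∈ Icc a b, HasDerivAt f (f' x) x) (hg : ∀ x ∈ Icc a b, HasDerivAt g (g' x) x)
    (h : ∀ x ∈ Icc a b, f' x ≤ g' x) : f b - f a ≤ g b - g a := by
  have hmono : MonotoneOn (fun x => g x - f x) (Icc a b) := by
    refine monotoneOn_of_deriv_nonneg (convex_Icc a b) ?_ ?_ ?_
    · exact fun x hx => ((hg x hx).sub (hf x hx)).continuousAt.continuousWithinAt
    · exact fun x hx => ((hg x (interior_subset hx)).sub
        (hf x (interior_subset hx))).differentiableAt.differentiableWithinAt
    · intro x hx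
      have hx' := interior_subset hx
      rw [((hg x hx').fun_sub (hf x hx')).deriv]
      exact sub_nonneg.2 (h x hx')
  have := hmono (left_mem_Icc.2 hab) (right_mem_Icc.2 hab) hab
  simp only at this
  linarith

theorem strictMonoOn_of_hasDerivAt_pos {f f' : ℝ → ℝ} {D : Set ℝ} (hD : Convex ℝ D)
    (hf : ∀ x ∈ D, HasDerivAt f (f' x) x) (h : ∀ x ∈ interior D, 0 < f' x) :
    StrictMonoOn f D :=
  strictMonoOn_of_deriv_pos hD (fun x hx => (hf x hx).continuousAt.continuousWithinAt)
    fun x hx => by rw [(hf x (interior_subset hx)).deriv]; exact h x hx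

theorem strictAntiOn_of_hasDerivAt_neg {f f' : ℝ → ℝ} {D : Set ℝ} (hD : Convex ℝ D)
    (hf : ∀ x ∈ D, HasDerivAt f (f' x) x) (h : ∀ x ∈ interior D, f' x < 0) :
    StrictAntiOn f D :=
  strictAntiOn_of_deriv_neg hD (fun x hx => (hf x hx).continuousAt.continuousWithinAt)
    fun x hx => by rw [(hf x (interior_subset hx)).deriv]; exact h x hx

theorem uIcc_subset_Ioi_zero {a x : ℝ} (ha : 0 < a) (hx : 0 < x) : uIcc a x ⊆ Ioi 0 :=
  fun _ hy => lt_of_lt_of_le (lt_min ha hx) hy.1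

theorem intervalIntegrable_of_continuousOn_Ioi {f : ℝ → ℝ} (hf : ContinuousOn f (Ioi 0)) {a x : ℝ}
    (ha : 0 < a) (hx : 0 < x) : IntervalIntegrable f volume a x :=
  (hf.mono (uIcc_subset_Ioi_zero ha hx)).intervalIntegrable

theorem hasDerivAt_integral_of_continuousOn_Ioi {f : ℝ → ℝ} (hf : ContinuousOn f (Ioi 0)) {a x : ℝ}
    (ha : 0 < a) (hx : 0 < x) : HasDerivAt (fun y => ∫ s in a..y, f s) (f x) x :=
  intervalIntegral.integral_hasDerivAt_right (intervalIntegrable_of_continuousOn_Ioi hf ha hx)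
    (hf.stronglyMeasurableAtFilter isOpen_Ioi x hx) (hf.continuousAt (Ioi_mem_nhds hx))

/-- If the primitives of a nonnegative function stayed bounded, the function would be integrable.
This and its counterpart at `0` convert inaccessibility into unbounded primitives, the form used in
the ODE estimates. -/
theorem exists_lt_integral_of_lintegral_Ioi_eq_top {k : ℝ → ℝ} (hk : ContinuousOn k (Ioi 0))
    (hnn : ∀ x, 1 ≤ x → 0 ≤ k x) (h : ∫⁻ x in Ioi (1 : ℝ), ENNReal.ofReal (k x) = ⊤) (B : ℝ) :
    ∃ x, 1 ≤ x ∧ B < ∫ y in (1 : ℝ)..x, k y := by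
  by_contra! hB
  have hint : IntegrableOn k (Ioi 1) := by
    refine integrableOn_Ioi_of_intervalIntegral_norm_bounded (l := atTop) (b := id) B 1 ?_
      tendsto_id ?_
    · intro i
      refine ((hk.mono ?_).integrableOn_Icc (a := 1) (b := i)).mono_set Ioc_subset_Icc_self
      exact fun y hy => lt_of_lt_of_le one_pos hy.1
    · filter_upwards [eventually_ge_atTop 1] with i hi
      refine le_trans (le_of_eq ?_) (hB i hi)
      refine intervalIntegral.integral_congr fun y hy => ?_
      rw [uIcc_of_le (by exact hi)] at hy
      exact Real.norm_of_nonneg (hnn y hy.1)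
  have := hint.lintegral_lt_top
  simp [h] at this

theorem exists_lt_integral_of_lintegral_Ioo_eq_top {k : ℝ → ℝ} (hk : ContinuousOn k (Ioi 0))
    (hnn : ∀ x, 0 < x → x ≤ 1 → 0 ≤ k x)
    (h : ∫⁻ x in Ioo (0 : ℝ) 1, ENNReal.ofReal (k x) = ⊤) (B : ℝ) :
    ∃ x, 0 < x ∧ x ≤ 1 ∧ B < ∫ y in x..(1 : ℝ), k y := by
  by_contra! hB
  have hpos : ∀ n : ℕ, (0 : ℝ) < 1 / ((n : ℝ) + 1) := fun n => Nat.one_div_pos_of_nat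
  have hint : IntegrableOn k (Ioc 0 1) := by
    refine integrableOn_Ioc_of_intervalIntegral_norm_bounded_left (l := atTop)
      (a := fun n : ℕ => 1 / ((n : ℝ) + 1)) (I := B) ?_ tendsto_one_div_add_atTop_nhds_zero_nat ?_
    · intro i
      refine ((hk.mono ?_).integrableOn_Icc (a := 1 / ((i : ℝ) + 1)) (b := 1)).mono_set
        Ioc_subset_Icc_self
      exact fun y hy => lt_of_lt_of_le (hpos i) hy.1
    · refine Eventually.of_forall fun i => ?_
      have hi : 1 / ((i : ℝ) + 1) ≤ 1 := by
        rw [div_le_one (by positivity)]; simp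
      refine le_trans (le_of_eq ?_) (hB _ (hpos i) hi)
      rw [intervalIntegral.integral_of_le hi]
      refine setIntegral_congr_fun measurableSet_Ioc fun y hy => ?_
      exact Real.norm_of_nonneg (hnn y ((hpos i).trans hy.1) hy.2)
  have := (hint.mono_set Ioo_subset_Ioc_self).lintegral_lt_top
  simp [h] at this

/-- A diffusion on `]0, ∞[` with inaccessible end points, a discounting rate bounded away from
`0`, and the two monotone fundamental solutions of `𝓛 w = 0`. -/
structure FundamentalPair (b σ r φ ψ : ℝ → ℝ) : Prop where
  continuousOn_b : ContinuousOn b (Ioi 0)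
  continuousOn_σ : ContinuousOn σ (Ioi 0)
  σ_pos : ∀ x, 0 < x → 0 < σ x
  continuousOn_r : ContinuousOn r (Ioi 0)
  exists_le_r : ∃ r₀, 0 < r₀ ∧ ∀ x, 0 < x → r₀ ≤ r x
  zero : ZeroInaccessible b σ
  infty : InftyInaccessible b σ
  dec : IsDecreasingSolution b σ r φ
  inc : IsIncreasingSolution b σ r ψ

/-! ### Scale function, speed density and Wronskian -/

theorem scaleDeriv_pos (b σ : ℝ → ℝ) (x : ℝ) : 0 < scaleDeriv b σ x := Real.exp_pos _

namespace IsPositiveSolution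

variable {b σ r w : ℝ → ℝ} {x : ℝ}

theorem hasDerivAt (hw : IsPositiveSolution b σ r w) (hx : 0 < x) : HasDerivAt w (deriv w x) x :=
  ((hw.contDiffOn.differentiableOn (by norm_num)).differentiableAt (Ioi_mem_nhds hx)).hasDerivAt

theorem contDiffOn_deriv (hw : IsPositiveSolution b σ r w) : ContDiffOn ℝ 1 (deriv w) (Ioi 0) :=
  hw.contDiffOn.deriv_of_isOpen isOpen_Ioi (by norm_num)

theorem hasDerivAt_deriv (hw : IsPositiveSolution b σ r w) (hx : 0 < x) :
    HasDerivAt (deriv w) (deriv (deriv w) x) x :=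
  ((hw.contDiffOn_deriv.differentiableOn (by norm_num)).differentiableAt
    (Ioi_mem_nhds hx)).hasDerivAt

theorem continuousOn (hw : IsPositiveSolution b σ r w) : ContinuousOn w (Ioi 0) :=
  hw.contDiffOn.continuousOn

theorem deriv_deriv_eq (hw : IsPositiveSolution b σ r w) (hσ : 0 < σ x) (hx : 0 < x) :
    deriv (deriv w) x = 2 / σ x ^ 2 * (r x * w x - b x * deriv w x) := by
  have := hw.ode x hx
  unfold discountedGenerator generator at this
  field_simp
  linarith

end IsPositiveSolution

namespace FundamentalPair

variable {b σ r φ ψ : ℝ → ℝ} {x : ℝ}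

theorem hasDerivAt_scaleDeriv (h : FundamentalPair b σ r φ ψ) (hx : 0 < x) :
    HasDerivAt (scaleDeriv b σ) (-2 * (b x / σ x ^ 2) * scaleDeriv b σ x) x := by
  have hc : ContinuousOn (fun s => b s / σ s ^ 2) (Ioi 0) :=
    h.continuousOn_b.div (h.continuousOn_σ.pow 2) fun y hy => (pow_pos (h.σ_pos y hy) 2).ne'
  have := ((hasDerivAt_integral_of_continuousOn_Ioi hc one_pos hx).const_mul (-2)).exp
  rw [mul_comm]
  exact this

theorem continuousOn_scaleDeriv (h : FundamentalPair b σ r φ ψ) :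
    ContinuousOn (scaleDeriv b σ) (Ioi 0) :=
  fun _ hx => (h.hasDerivAt_scaleDeriv hx).continuousAt.continuousWithinAt

theorem speedDensity_pos (h : FundamentalPair b σ r φ ψ) (hx : 0 < x) :
    0 < speedDensity b σ x :=
  div_pos two_pos (mul_pos (pow_pos (h.σ_pos x hx) 2) (scaleDeriv_pos b σ x))

theorem continuousOn_speedDensity (h : FundamentalPair b σ r φ ψ) :
    ContinuousOn (speedDensity b σ) (Ioi 0) :=
  continuousOn_const.div ((h.continuousOn_σ.pow 2).mul h.continuousOn_scaleDeriv) fun y hy =>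
    (mul_pos (pow_pos (h.σ_pos y hy) 2) (scaleDeriv_pos b σ y)).ne'

theorem r_pos (h : FundamentalPair b σ r φ ψ) (hx : 0 < x) : 0 < r x := by
  obtain ⟨r₀, h0, h1⟩ := h.exists_le_r
  exact h0.trans_le (h1 x hx)

/-- The derivative with respect to the scale function of a solution of `𝓛 w = 0`. -/
theorem hasDerivAt_deriv_div_scaleDeriv (h : FundamentalPair b σ r φ ψ) {w : ℝ → ℝ}
    (hw : IsPositiveSolution b σ r w) (hx : 0 < x) :
    HasDerivAt (fun y => deriv w y / scaleDeriv b σ y) (r x * w x * speedDensity b σ x) x := by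
  have hs := (scaleDeriv_pos b σ x).ne'
  have hσ := h.σ_pos x hx
  refine ((hw.hasDerivAt_deriv hx).div (h.hasDerivAt_scaleDeriv hx) hs).congr_deriv ?_
  rw [hw.deriv_deriv_eq hσ hx, speedDensity]
  field_simp
  ring

/-- Differentiated with respect to scale, the Wronskian has derivative `φ·rψm - rφm·ψ = 0` (with `m`
the speed density), and its value at `1` is `C` because `p'(1) = 1`. -/
theorem wronskian_eq (h : FundamentalPair b σ r φ ψ) (hx : 0 < x) :
    φ x * deriv ψ x - deriv φ x * ψ x = wronskianConst φ ψ * scaleDeriv b σ x := by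
  have hd : ∀ y ∈ Ioi (0 : ℝ), HasDerivAt (fun y => φ y * (deriv ψ y / scaleDeriv b σ y)
      - deriv φ y / scaleDeriv b σ y * ψ y) 0 y := by
    intro y hy
    refine (((h.dec.hasDerivAt hy).mul
      (h.hasDerivAt_deriv_div_scaleDeriv h.inc.toIsPositiveSolution hy)).sub
      ((h.hasDerivAt_deriv_div_scaleDeriv h.dec.toIsPositiveSolution hy).mul
      (h.inc.hasDerivAt hy))).congr_deriv ?_
    ring
  have := isOpen_Ioi.is_const_of_deriv_eq_zero (convex_Ioi (0 : ℝ)).isPreconnected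
    (fun y hy => (hd y hy).differentiableAt.differentiableWithinAt)
    (fun y hy => (hd y hy).deriv) (mem_Ioi.2 hx) (mem_Ioi.2 one_pos)
  have hs := (scaleDeriv_pos b σ x).ne'
  have h1 : scaleDeriv b σ 1 = 1 := by simp [scaleDeriv]
  simp only [h1, div_one] at this
  rw [wronskianConst, ← this]
  field_simp

theorem wronskianConst_pos (h : FundamentalPair b σ r φ ψ) : 0 < wronskianConst φ ψ := by
  have h1 := mul_pos (h.dec.pos 1 one_pos) (h.inc.deriv_pos 1 one_pos)
  have h2 := mul_pos (neg_pos.2 (h.dec.deriv_neg 1 one_pos)) (h.inc.pos 1 one_pos)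
  unfold wronskianConst
  linarith

/-! ### Boundary behaviour of the fundamental solutions -/

theorem hasDerivAt_speed (h : FundamentalPair b σ r φ ψ) (hx : 0 < x) :
    HasDerivAt (fun y => ∫ s in (1 : ℝ)..y, speedDensity b σ s) (speedDensity b σ x) x :=
  hasDerivAt_integral_of_continuousOn_Ioi h.continuousOn_speedDensity one_pos hx

theorem continuousOn_scaleDeriv_mul_speed (h : FundamentalPair b σ r φ ψ) :
    ContinuousOn (fun y => scaleDeriv b σ y * ∫ s in (1 : ℝ)..y, speedDensity b σ s) (Ioi 0) :=
  h.continuousOn_scaleDeriv.mul fun _ hx =>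
    (h.hasDerivAt_speed hx).continuousAt.continuousWithinAt

theorem speed_nonneg (h : FundamentalPair b σ r φ ψ) (hx : 1 ≤ x) :
    0 ≤ ∫ s in (1 : ℝ)..x, speedDensity b σ s :=
  intervalIntegral.integral_nonneg hx fun _ hy => (h.speedDensity_pos (one_pos.trans_le hy.1)).le

theorem speed_nonpos (h : FundamentalPair b σ r φ ψ) (h0 : 0 < x) (hx : x ≤ 1) :
    ∫ s in (1 : ℝ)..x, speedDensity b σ s ≤ 0 := by
  rw [intervalIntegral.integral_symm]
  exact neg_nonpos.2 <| intervalIntegral.integral_nonneg hx fun y hy =>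
    (h.speedDensity_pos (h0.trans_le hy.1)).le

theorem exists_lt_integral_scaleDeriv_mul_speed_right (h : FundamentalPair b σ r φ ψ) (B : ℝ) :
    ∃ x, 1 ≤ x ∧
      B < ∫ y in (1 : ℝ)..x, scaleDeriv b σ y * ∫ s in (1 : ℝ)..y, speedDensity b σ s :=
  exists_lt_integral_of_lintegral_Ioi_eq_top h.continuousOn_scaleDeriv_mul_speed
    (fun _ hx => mul_nonneg (scaleDeriv_pos b σ _).le (h.speed_nonneg hx)) h.infty B

/-- Both integrals start at `1`, so for `x ≤ 1` the two reversals of orientation cancel and the same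
primitive serves at both ends of the half line. -/
theorem exists_lt_integral_scaleDeriv_mul_speed_left (h : FundamentalPair b σ r φ ψ) (B : ℝ) :
    ∃ x, 0 < x ∧ x ≤ 1 ∧
      B < ∫ y in (1 : ℝ)..x, scaleDeriv b σ y * ∫ s in (1 : ℝ)..y, speedDensity b σ s := by
  obtain ⟨x, h0, h1, hB⟩ := exists_lt_integral_of_lintegral_Ioo_eq_top
    (k := fun y => scaleDeriv b σ y * ∫ s in y..(1 : ℝ), speedDensity b σ s)
    (by
      refine h.continuousOn_scaleDeriv_mul_speed.neg.congr fun _ _ => ?_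
      simp only [Pi.neg_apply]
      rw [intervalIntegral.integral_symm, mul_neg])
    (fun _ h0 hx => mul_nonneg (scaleDeriv_pos b σ _).le (by
      rw [intervalIntegral.integral_symm]
      exact neg_nonneg.2 (h.speed_nonpos h0 hx))) h.zero B
  refine ⟨x, h0, h1, hB.trans_eq ?_⟩
  rw [intervalIntegral.integral_symm, ← intervalIntegral.integral_neg]
  refine intervalIntegral.integral_congr fun y _ => ?_
  rw [intervalIntegral.integral_symm y 1, mul_neg]

theorem hasDerivAt_integral_scaleDeriv_mul_speed (h : FundamentalPair b σ r φ ψ) (hx : 0 < x) :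
    HasDerivAt (fun x => ∫ y in (1 : ℝ)..x, scaleDeriv b σ y * ∫ s in (1 : ℝ)..y,
      speedDensity b σ s) (scaleDeriv b σ x * ∫ s in (1 : ℝ)..x, speedDensity b σ s) x :=
  hasDerivAt_integral_of_continuousOn_Ioi h.continuousOn_scaleDeriv_mul_speed one_pos hx

theorem strictMonoOn_inc (h : FundamentalPair b σ r φ ψ) : StrictMonoOn ψ (Ioi 0) :=
  strictMonoOn_of_hasDerivAt_pos (convex_Ioi 0) (fun _ hx => h.inc.hasDerivAt hx)
    fun _ hx => h.inc.deriv_pos _ (interior_subset hx)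

theorem strictAntiOn_dec (h : FundamentalPair b σ r φ ψ) : StrictAntiOn φ (Ioi 0) :=
  strictAntiOn_of_hasDerivAt_neg (convex_Ioi 0) (fun _ hx => h.dec.hasDerivAt hx)
    fun _ hx => h.dec.deriv_neg _ (interior_subset hx)

theorem strictMonoOn_deriv_div_scaleDeriv (h : FundamentalPair b σ r φ ψ) {w : ℝ → ℝ}
    (hw : IsPositiveSolution b σ r w) :
    StrictMonoOn (fun y => deriv w y / scaleDeriv b σ y) (Ioi 0) :=
  strictMonoOn_of_hasDerivAt_pos (convex_Ioi 0)
    (fun _ hx => h.hasDerivAt_deriv_div_scaleDeriv hw hx) fun x hx => by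
      have hx : 0 < x := interior_subset hx
      exact mul_pos (mul_pos (h.r_pos hx) (hw.pos x hx)) (h.speedDensity_pos hx)

/-- On `[1, ∞[` the equation gives `(ψ'/p')' = rψm ≥ r₀ψ(1)m`. Integrating twice bounds `ψ` below by
a multiple of the primitive of `p'(y) m(]1, y[)`, which is unbounded. -/
theorem tendsto_inc_atTop (h : FundamentalPair b σ r φ ψ) : Tendsto ψ atTop atTop := by
  obtain ⟨r₀, hr0, hr⟩ := h.exists_le_r
  have h1 := h.inc.pos 1 one_pos
  refine tendsto_atTop.2 fun B => ?_
  obtain ⟨x, hx1, hx⟩ := h.exists_lt_integral_scaleDeriv_mul_speed_right (B / (r₀ * ψ 1))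
  have hx0 : 0 < x := one_pos.trans_le hx1
  filter_upwards [eventually_ge_atTop x] with y hy
  refine le_trans ?_ (h.strictMonoOn_inc.monotoneOn (mem_Ioi.2 hx0)
    (mem_Ioi.2 (hx0.trans_le hy)) hy)
  have key := sub_le_sub_of_hasDerivAt hx1
    (fun y hy => (h.hasDerivAt_integral_scaleDeriv_mul_speed
      (one_pos.trans_le hy.1)).const_mul (r₀ * ψ 1))
    (fun y hy => h.inc.hasDerivAt (one_pos.trans_le hy.1)) (by
      intro y hy
      have hy0 := one_pos.trans_le hy.1
      have := sub_le_sub_of_hasDerivAt hy.1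
        (fun z hz => (h.hasDerivAt_speed (one_pos.trans_le hz.1)).const_mul (r₀ * ψ 1))
        (fun z hz => h.hasDerivAt_deriv_div_scaleDeriv h.inc.toIsPositiveSolution
          (one_pos.trans_le hz.1)) (by
          intro z hz
          have hz0 := one_pos.trans_le hz.1
          have := h.strictMonoOn_inc.monotoneOn (mem_Ioi.2 one_pos) (mem_Ioi.2 hz0) hz.1
          have h2 := (h.speedDensity_pos hz0).le
          have h3 := hr z hz0
          have h5 := hr0.le.trans h3
          gcongr)
      simp only [intervalIntegral.integral_same, mul_zero, sub_zero] at this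
      have hp : 0 < deriv ψ 1 / scaleDeriv b σ 1 :=
        div_pos (h.inc.deriv_pos 1 one_pos) (scaleDeriv_pos _ _ _)
      have h4 : r₀ * ψ 1 * ∫ s in (1 : ℝ)..y, speedDensity b σ s
          ≤ deriv ψ y / scaleDeriv b σ y := by linarith
      rw [le_div_iff₀ (scaleDeriv_pos b σ y)] at h4
      linarith)
  simp only [intervalIntegral.integral_same, mul_zero, sub_zero] at key
  rw [div_lt_iff₀ (by positivity)] at hx
  linarith

/-- The mirror image of `tendsto_inc_atTop`, integrating from `1` towards `0`. -/
theorem tendsto_dec_zero (h : FundamentalPair b σ r φ ψ) : Tendsto φ (𝓝[>] 0) atTop := by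
  obtain ⟨r₀, hr0, hr⟩ := h.exists_le_r
  have h1 := h.dec.pos 1 one_pos
  refine tendsto_atTop.2 fun B => ?_
  obtain ⟨x, hx0, hx1, hx⟩ := h.exists_lt_integral_scaleDeriv_mul_speed_left (B / (r₀ * φ 1))
  filter_upwards [Ioo_mem_nhdsGT hx0] with y hy
  refine le_trans ?_ (h.strictAntiOn_dec.antitoneOn (mem_Ioi.2 hy.1) (mem_Ioi.2 hx0) hy.2.le)
  have key := sub_le_sub_of_hasDerivAt hx1
    (fun y hy => h.dec.hasDerivAt (hx0.trans_le hy.1))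
    (fun y hy => (h.hasDerivAt_integral_scaleDeriv_mul_speed
      (hx0.trans_le hy.1)).const_mul (r₀ * φ 1)) (by
      intro y hy
      have hy0 := hx0.trans_le hy.1
      have := sub_le_sub_of_hasDerivAt hy.2
        (fun z hz => (h.hasDerivAt_speed (hy0.trans_le hz.1)).const_mul (r₀ * φ 1))
        (fun z hz => h.hasDerivAt_deriv_div_scaleDeriv h.dec.toIsPositiveSolution
          (hy0.trans_le hz.1)) (by
          intro z hz
          have hz0 := hy0.trans_le hz.1
          have := h.strictAntiOn_dec.antitoneOn (mem_Ioi.2 hz0) (mem_Ioi.2 one_pos) hz.2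
          have h2 := (h.speedDensity_pos hz0).le
          have h3 := hr z hz0
          have h5 := hr0.le.trans h3
          gcongr)
      simp only [intervalIntegral.integral_same, mul_zero, zero_sub] at this
      have hp : deriv φ 1 / scaleDeriv b σ 1 < 0 :=
        div_neg_of_neg_of_pos (h.dec.deriv_neg 1 one_pos) (scaleDeriv_pos _ _ _)
      have h4 : deriv φ y / scaleDeriv b σ y ≤
          r₀ * φ 1 * ∫ s in (1 : ℝ)..y, speedDensity b σ s := by linarith
      rw [div_le_iff₀ (scaleDeriv_pos b σ y)] at h4
      linarith)
  simp only [intervalIntegral.integral_same, mul_zero, zero_sub] at key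
  rw [div_lt_iff₀ (by positivity)] at hx
  linarith

/-- The ratio is negative and increasing, so only a bound `φ'/p' ≤ κ < 0` on `[1, ∞[` must be
excluded. Let `m(y)` be the speed integral from `1` to `y` and `V' = p'm`. Then `(φm - κV)' ≤ φm' ≤
(φ'/p')'/r₀`, and integration bounds `-κV`, against inaccessibility of `∞`. -/
theorem tendsto_deriv_dec_div_scaleDeriv (h : FundamentalPair b σ r φ ψ) :
    Tendsto (fun y => deriv φ y / scaleDeriv b σ y) atTop (𝓝 0) := by
  obtain ⟨r₀, hr0, hr⟩ := h.exists_le_r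
  have hneg : ∀ y, 0 < y → deriv φ y / scaleDeriv b σ y < 0 := fun y hy =>
    div_neg_of_neg_of_pos (h.dec.deriv_neg y hy) (scaleDeriv_pos _ _ _)
  have hmono := (h.strictMonoOn_deriv_div_scaleDeriv h.dec.toIsPositiveSolution).monotoneOn
  refine tendsto_order.2 ⟨fun κ hκ => ?_, fun κ hκ => ?_⟩
  · obtain ⟨x, hx1, hx⟩ : ∃ x, 1 ≤ x ∧ κ < deriv φ x / scaleDeriv b σ x := by
      by_contra! hle
      obtain ⟨x, hx1, hx⟩ := h.exists_lt_integral_scaleDeriv_mul_speed_right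
        (-(deriv φ 1 / scaleDeriv b σ 1) / r₀ / -κ)
      have hx0 := one_pos.trans_le hx1
      have key := sub_le_sub_of_hasDerivAt hx1
        (fun y hy => ((h.hasDerivAt_integral_scaleDeriv_mul_speed
          (one_pos.trans_le hy.1)).const_mul (-κ)).fun_add
          ((h.dec.hasDerivAt (one_pos.trans_le hy.1)).fun_mul
            (h.hasDerivAt_speed (one_pos.trans_le hy.1))))
        (fun y hy => (h.hasDerivAt_deriv_div_scaleDeriv h.dec.toIsPositiveSolution
          (one_pos.trans_le hy.1)).const_mul (1 / r₀)) (by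
          intro y hy
          have hy0 := one_pos.trans_le hy.1
          have h1 := hle y hy.1
          rw [div_le_iff₀ (scaleDeriv_pos b σ y)] at h1
          have h2 := mul_le_mul_of_nonneg_right h1 (h.speed_nonneg hy.1)
          have h3 : 1 ≤ r y / r₀ := (one_le_div hr0).2 (hr y hy0)
          have h4 := mul_le_mul_of_nonneg_right h3
            (mul_pos (h.dec.pos y hy0) (h.speedDensity_pos hy0)).le
          have h5 : 1 / r₀ * (r y * φ y * speedDensity b σ y)
            = r y / r₀ * (φ y * speedDensity b σ y) := by ring
          rw [h5]
          linarith)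
      simp only [intervalIntegral.integral_same, mul_zero, add_zero, sub_zero] at key
      have h1 := mul_nonneg (h.dec.pos x hx0).le (h.speed_nonneg hx1)
      rw [div_lt_iff₀ (by linarith), div_lt_iff₀ hr0] at hx
      have h2 := hneg x hx0
      rw [← mul_sub, one_div, inv_mul_eq_div, le_div_iff₀ hr0] at key
      nlinarith
    filter_upwards [eventually_ge_atTop x] with y hy
    exact hx.trans_le (hmono (mem_Ioi.2 (one_pos.trans_le hx1))
      (mem_Ioi.2 (one_pos.trans_le (hx1.trans hy))) hy)
  · filter_upwards [eventually_gt_atTop 0] with y hy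
    exact (hneg y hy).trans hκ

/-- The same argument at `0`: a bound `ψ'/p' ≥ κ > 0` on `]0, 1]` would make `V` bounded there,
through `(ψm - κV)' ≤ (ψ'/p')'/r₀`; the inequality uses that `m(y) ≤ 0` for `y ≤ 1`. -/
theorem tendsto_deriv_inc_div_scaleDeriv (h : FundamentalPair b σ r φ ψ) :
    Tendsto (fun y => deriv ψ y / scaleDeriv b σ y) (𝓝[>] 0) (𝓝 0) := by
  obtain ⟨r₀, hr0, hr⟩ := h.exists_le_r
  have hpos : ∀ y, 0 < y → 0 < deriv ψ y / scaleDeriv b σ y := fun y hy =>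
    div_pos (h.inc.deriv_pos y hy) (scaleDeriv_pos _ _ _)
  have hmono := (h.strictMonoOn_deriv_div_scaleDeriv h.inc.toIsPositiveSolution).monotoneOn
  refine tendsto_order.2 ⟨fun κ hκ => ?_, fun κ hκ => ?_⟩
  · filter_upwards [self_mem_nhdsWithin] with y hy
    exact hκ.trans (hpos y hy)
  · obtain ⟨x, hx0, hx1, hx⟩ : ∃ x, 0 < x ∧ x ≤ 1 ∧ deriv ψ x / scaleDeriv b σ x < κ := by
      by_contra! hle
      obtain ⟨x, hx0, hx1, hx⟩ := h.exists_lt_integral_scaleDeriv_mul_speed_left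
        ((deriv ψ 1 / scaleDeriv b σ 1) / r₀ / κ)
      have key := sub_le_sub_of_hasDerivAt hx1
        (fun y hy => ((h.inc.hasDerivAt (hx0.trans_le hy.1)).fun_mul
            (h.hasDerivAt_speed (hx0.trans_le hy.1))).fun_sub
            ((h.hasDerivAt_integral_scaleDeriv_mul_speed
          (hx0.trans_le hy.1)).const_mul κ))
        (fun y hy => (h.hasDerivAt_deriv_div_scaleDeriv h.inc.toIsPositiveSolution
          (hx0.trans_le hy.1)).const_mul (1 / r₀)) (by
          intro y hy
          have hy0 := hx0.trans_le hy.1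
          have h1 := hle y hy0 hy.2
          rw [le_div_iff₀ (scaleDeriv_pos b σ y)] at h1
          have h2 := mul_le_mul_of_nonneg_right h1 (neg_nonneg.2 (h.speed_nonpos hy0 hy.2))
          have h3 : 1 ≤ r y / r₀ := (one_le_div hr0).2 (hr y hy0)
          have h4 := mul_le_mul_of_nonneg_right h3
            (mul_pos (h.inc.pos y hy0) (h.speedDensity_pos hy0)).le
          have h5 : 1 / r₀ * (r y * ψ y * speedDensity b σ y)
            = r y / r₀ * (ψ y * speedDensity b σ y) := by ring
          rw [h5]
          linarith)
      simp only [intervalIntegral.integral_same, mul_zero, zero_sub, sub_zero] at key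
      have h1 := mul_nonneg (h.inc.pos x hx0).le (neg_nonneg.2 (h.speed_nonpos hx0 hx1))
      rw [div_lt_iff₀ hκ, div_lt_iff₀ hr0] at hx
      have h2 := hpos x hx0
      rw [← mul_sub, one_div, inv_mul_eq_div, le_div_iff₀ hr0] at key
      nlinarith
    filter_upwards [Ioo_mem_nhdsGT hx0] with y hy
    exact (hmono (mem_Ioi.2 hy.1) (mem_Ioi.2 hx0) hy.2.le).trans_lt hx

end FundamentalPair

/-! ### The Green operator -/

theorem integrableOn_Ioc_and_integral_eq_of_hasDerivAt_of_tendsto {H H' : ℝ → ℝ}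
    (hH : ∀ x, 0 < x → HasDerivAt H (H' x) x) (hnn : ∀ x, 0 < x → 0 ≤ H' x)
    (hlim : Tendsto H (𝓝[>] 0) (𝓝 0)) {x : ℝ} (hx : 0 < x) :
    IntegrableOn H' (Ioc 0 x) ∧ ∫ s in Ioc 0 x, H' s = H x := by
  -- The value of `H` at `0` is arbitrary; resetting it to the limit makes the fundamental theorem
  -- of calculus applicable up to the end point.
  have hcont : ContinuousOn (Function.update H 0 0) (Icc 0 x) := by
    intro y hy
    rcases hy.1.eq_or_lt with h0 | h0
    · rw [← h0]
      refine continuousWithinAt_update_same.2 (hlim.mono_left (nhdsWithin_mono _ ?_))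
      exact fun z hz => lt_of_le_of_ne hz.1.1 (Ne.symm hz.2)
    · exact ((continuousAt_update_of_ne h0.ne').2
        (hH y h0).continuousAt).continuousWithinAt
  have hderiv : ∀ y ∈ Ioo 0 x, HasDerivAt (Function.update H 0 0) (H' y) y := by
    intro y hy
    refine (hH y hy.1).congr_of_eventuallyEq ?_
    filter_upwards [Ioi_mem_nhds hy.1] with z hz
    exact Function.update_of_ne (ne_of_gt hz) _ _
  have hint : IntegrableOn H' (Ioc 0 x) :=
    intervalIntegral.integrableOn_deriv_of_nonneg hcont hderiv fun y hy => hnn y hy.1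
  refine ⟨hint, ?_⟩
  rw [← intervalIntegral.integral_of_le hx.le,
    intervalIntegral.integral_eq_sub_of_hasDerivAt_of_le hx.le hcont hderiv
      ((intervalIntegrable_iff_integrableOn_Ioc_of_le hx.le).2 hint)]
  simp [Function.update_of_ne hx.ne']

theorem integral_Ioc_eq_add {f : ℝ → ℝ} (hf : ∀ x, 0 < x → IntegrableOn f (Ioc 0 x)) {a x : ℝ}
    (ha : 0 < a) (hx : 0 < x) :
    ∫ s in Ioc 0 x, f s = (∫ s in Ioc 0 a, f s) + ∫ s in a..x, f s := by
  have hi : ∀ {y : ℝ}, 0 < y → IntervalIntegrable f volume 0 y := fun hy =>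
    (intervalIntegrable_iff_integrableOn_Ioc_of_le hy.le).2 (hf _ hy)
  rw [← intervalIntegral.integral_of_le hx.le, ← intervalIntegral.integral_of_le ha.le,
    intervalIntegral.integral_add_adjacent_intervals (hi ha) ((hi ha).symm.trans (hi hx))]

theorem integral_Ioi_eq_sub {f : ℝ → ℝ} (hf : ∀ x, 0 < x → IntegrableOn f (Ioi x)) {a x : ℝ}
    (ha : 0 < a) (hx : 0 < x) :
    ∫ s in Ioi x, f s = (∫ s in Ioi a, f s) - ∫ s in a..x, f s := by
  rw [← intervalIntegral.integral_Ioi_sub_Ioi' (hf a ha) (hf x hx)]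
  ring

theorem hasDerivAt_integral_Ioc {f : ℝ → ℝ} (hc : ContinuousOn f (Ioi 0))
    (hf : ∀ x, 0 < x → IntegrableOn f (Ioc 0 x)) {x : ℝ} (hx : 0 < x) :
    HasDerivAt (fun y => ∫ s in Ioc 0 y, f s) (f x) x := by
  refine ((hasDerivAt_integral_of_continuousOn_Ioi hc one_pos hx).const_add
    (∫ s in Ioc 0 1, f s)).congr_of_eventuallyEq ?_
  filter_upwards [Ioi_mem_nhds hx] with y hy
  exact integral_Ioc_eq_add hf one_pos hy

theorem hasDerivAt_integral_Ioi {f : ℝ → ℝ} (hc : ContinuousOn f (Ioi 0))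
    (hf : ∀ x, 0 < x → IntegrableOn f (Ioi x)) {x : ℝ} (hx : 0 < x) :
    HasDerivAt (fun y => ∫ s in Ioi y, f s) (-f x) x := by
  refine ((hasDerivAt_integral_of_continuousOn_Ioi hc one_pos hx).const_sub
    (∫ s in Ioi 1, f s)).congr_of_eventuallyEq ?_
  filter_upwards [Ioi_mem_nhds hx] with y hy
  exact integral_Ioi_eq_sub hf one_pos hy

noncomputable section

/-- The function `Φ = 2 φ / (C σ² p')`. -/
def bigPhi (b σ φ ψ : ℝ → ℝ) (x : ℝ) : ℝ :=
  2 * φ x / (wronskianConst φ ψ * σ x ^ 2 * scaleDeriv b σ x)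

/-- `φ(x) ∫₀ˣ F Ψ ds + ψ(x) ∫ₓ^∞ F Φ ds`. -/
def greenFun (b σ φ ψ F : ℝ → ℝ) (x : ℝ) : ℝ :=
  φ x * (∫ s in Ioc 0 x, F s * bigPsi b σ φ ψ s) + ψ x * ∫ s in Ioi x, F s * bigPhi b σ φ ψ s

/-- The derivative of `greenFun`. -/
def greenDeriv (b σ φ ψ F : ℝ → ℝ) (x : ℝ) : ℝ :=
  deriv φ x * (∫ s in Ioc 0 x, F s * bigPsi b σ φ ψ s) +
    deriv ψ x * ∫ s in Ioi x, F s * bigPhi b σ φ ψ s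

end

/-- The Green operator is applicable to `F`. -/
structure GreenIntegrable (b σ φ ψ F : ℝ → ℝ) : Prop where
  continuousOn : ContinuousOn F (Ioi 0)
  left : ∀ x, 0 < x → IntegrableOn (fun s => F s * bigPsi b σ φ ψ s) (Ioc 0 x)
  right : ∀ x, 0 < x → IntegrableOn (fun s => F s * bigPhi b σ φ ψ s) (Ioi x)

namespace FundamentalPair

variable {b σ r φ ψ F : ℝ → ℝ} {x : ℝ}

theorem bigPsi_pos (h : FundamentalPair b σ r φ ψ) (hx : 0 < x) : 0 < bigPsi b σ φ ψ x :=
  div_pos (mul_pos two_pos (h.inc.pos x hx)) (mul_pos (mul_pos h.wronskianConst_pos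
    (pow_pos (h.σ_pos x hx) 2)) (scaleDeriv_pos b σ x))

theorem bigPhi_pos (h : FundamentalPair b σ r φ ψ) (hx : 0 < x) : 0 < bigPhi b σ φ ψ x :=
  div_pos (mul_pos two_pos (h.dec.pos x hx)) (mul_pos (mul_pos h.wronskianConst_pos
    (pow_pos (h.σ_pos x hx) 2)) (scaleDeriv_pos b σ x))

theorem continuousOn_bigPsi (h : FundamentalPair b σ r φ ψ) :
    ContinuousOn (bigPsi b σ φ ψ) (Ioi 0) :=
  (continuousOn_const.mul h.inc.continuousOn).div
    ((continuousOn_const.mul (h.continuousOn_σ.pow 2)).mul h.continuousOn_scaleDeriv) fun x hx =>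
    (mul_pos (mul_pos h.wronskianConst_pos (pow_pos (h.σ_pos x hx) 2)) (scaleDeriv_pos b σ x)).ne'

theorem continuousOn_bigPhi (h : FundamentalPair b σ r φ ψ) :
    ContinuousOn (bigPhi b σ φ ψ) (Ioi 0) :=
  (continuousOn_const.mul h.dec.continuousOn).div
    ((continuousOn_const.mul (h.continuousOn_σ.pow 2)).mul h.continuousOn_scaleDeriv) fun x hx =>
    (mul_pos (mul_pos h.wronskianConst_pos (pow_pos (h.σ_pos x hx) 2)) (scaleDeriv_pos b σ x)).ne'

theorem dec_mul_bigPsi (x : ℝ) : φ x * bigPsi b σ φ ψ x = ψ x * bigPhi b σ φ ψ x := by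
  unfold bigPsi bigPhi
  ring

/-- The jump of the derivative of the Green kernel across the diagonal; it is the source of the term
`-F` in `𝓛u = -F`. -/
theorem deriv_mul_bigPsi_sub (h : FundamentalPair b σ r φ ψ) (hx : 0 < x) :
    deriv φ x * bigPsi b σ φ ψ x - deriv ψ x * bigPhi b σ φ ψ x = -(2 / σ x ^ 2) := by
  have h1 := h.wronskian_eq hx
  have h2 := h.wronskianConst_pos.ne'
  have h3 := (scaleDeriv_pos b σ x).ne'
  have h4 := (h.σ_pos x hx).ne'
  unfold bigPsi bigPhi
  field_simp
  linarith

theorem hasDerivAt_deriv_inc_div (h : FundamentalPair b σ r φ ψ) (hx : 0 < x) :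
    HasDerivAt (fun y => deriv ψ y / (wronskianConst φ ψ * scaleDeriv b σ y))
      (r x * bigPsi b σ φ ψ x) x := by
  have h2 := h.wronskianConst_pos.ne'
  have h3 := (scaleDeriv_pos b σ x).ne'
  have h4 := (h.σ_pos x hx).ne'
  refine (((h.hasDerivAt_deriv_div_scaleDeriv h.inc.toIsPositiveSolution hx).div_const
    (wronskianConst φ ψ)).congr_deriv ?_).congr_of_eventuallyEq (Eventually.of_forall fun y => ?_)
  · unfold speedDensity bigPsi
    field_simp
  · simp only
    rw [div_div, mul_comm]

theorem hasDerivAt_deriv_dec_div (h : FundamentalPair b σ r φ ψ) (hx : 0 < x) :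
    HasDerivAt (fun y => deriv φ y / (wronskianConst φ ψ * scaleDeriv b σ y))
      (r x * bigPhi b σ φ ψ x) x := by
  have h2 := h.wronskianConst_pos.ne'
  have h3 := (scaleDeriv_pos b σ x).ne'
  have h4 := (h.σ_pos x hx).ne'
  refine (((h.hasDerivAt_deriv_div_scaleDeriv h.dec.toIsPositiveSolution hx).div_const
    (wronskianConst φ ψ)).congr_deriv ?_).congr_of_eventuallyEq (Eventually.of_forall fun y => ?_)
  · unfold speedDensity bigPhi
    field_simp
  · simp only
    rw [div_div, mul_comm]

/-- The integrand is the derivative of `ψ'/(Cp')`, and inaccessibility of `0` removes the boundary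
term there. -/
theorem integrableOn_r_mul_bigPsi_and_integral (h : FundamentalPair b σ r φ ψ) (hx : 0 < x) :
    IntegrableOn (fun s => r s * bigPsi b σ φ ψ s) (Ioc 0 x) ∧
      ∫ s in Ioc 0 x, r s * bigPsi b σ φ ψ s
        = deriv ψ x / (wronskianConst φ ψ * scaleDeriv b σ x) := by
  refine integrableOn_Ioc_and_integral_eq_of_hasDerivAt_of_tendsto
    (H := fun y => deriv ψ y / (wronskianConst φ ψ * scaleDeriv b σ y))
    (fun y hy => h.hasDerivAt_deriv_inc_div hy)
    (fun y hy => (mul_pos (h.r_pos hy) (h.bigPsi_pos hy)).le) ?_ hx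
  have := h.tendsto_deriv_inc_div_scaleDeriv.div_const (wronskianConst φ ψ)
  rw [zero_div] at this
  refine this.congr fun y => ?_
  rw [div_div, mul_comm]

theorem tendsto_deriv_dec_div (h : FundamentalPair b σ r φ ψ) :
    Tendsto (fun y => deriv φ y / (wronskianConst φ ψ * scaleDeriv b σ y)) atTop (𝓝 0) := by
  have := h.tendsto_deriv_dec_div_scaleDeriv.div_const (wronskianConst φ ψ)
  rw [zero_div] at this
  refine this.congr fun y => ?_
  rw [div_div, mul_comm]

theorem integrableOn_r_mul_bigPhi (h : FundamentalPair b σ r φ ψ) (hx : 0 < x) :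
    IntegrableOn (fun s => r s * bigPhi b σ φ ψ s) (Ioi x) :=
  integrableOn_Ioi_deriv_of_nonneg' (fun _ hy => h.hasDerivAt_deriv_dec_div (hx.trans_le hy))
    (fun _ hy => (mul_pos (h.r_pos (hx.trans hy)) (h.bigPhi_pos (hx.trans hy))).le)
    h.tendsto_deriv_dec_div

theorem integral_r_mul_bigPhi (h : FundamentalPair b σ r φ ψ) (hx : 0 < x) :
    ∫ s in Ioi x, r s * bigPhi b σ φ ψ s
      = -(deriv φ x / (wronskianConst φ ψ * scaleDeriv b σ x)) := by
  rw [integral_Ioi_of_hasDerivAt_of_nonneg'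
    (fun y hy => h.hasDerivAt_deriv_dec_div (hx.trans_le hy))
    (fun y hy => (mul_pos (h.r_pos (hx.trans hy)) (h.bigPhi_pos (hx.trans hy))).le)
    h.tendsto_deriv_dec_div, zero_sub]

theorem greenIntegrable_r (h : FundamentalPair b σ r φ ψ) : GreenIntegrable b σ φ ψ r where
  continuousOn := h.continuousOn_r
  left _ hx := (h.integrableOn_r_mul_bigPsi_and_integral hx).1
  right _ hx := h.integrableOn_r_mul_bigPhi hx

/-- Both integrals are explicit, and what remains is the Wronskian divided by `Cp'`. This is the
analytic counterpart of `∫₀^∞ r e^{-Λ} dt = 1`. -/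
theorem greenFun_r (h : FundamentalPair b σ r φ ψ) (hx : 0 < x) :
    greenFun b σ φ ψ r x = 1 := by
  rw [greenFun, (h.integrableOn_r_mul_bigPsi_and_integral hx).2, h.integral_r_mul_bigPhi hx]
  have h1 := h.wronskian_eq hx
  have h2 := h.wronskianConst_pos.ne'
  have h3 := (scaleDeriv_pos b σ x).ne'
  field_simp
  linarith

theorem greenIntegrable_of_le (h : FundamentalPair b σ r φ ψ) (hF : ContinuousOn F (Ioi 0))
    (h0 : ∀ y, 0 < y → 0 ≤ F y) {M : ℝ} (hM : ∀ y, 0 < y → F y ≤ M * r y) :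
    GreenIntegrable b σ φ ψ F where
  continuousOn := hF
  left x hx := by
    refine ((h.greenIntegrable_r.left x hx).const_mul M).mono'
      (((hF.mul h.continuousOn_bigPsi).mono Ioc_subset_Ioi_self).aestronglyMeasurable
        measurableSet_Ioc) ?_
    filter_upwards [ae_restrict_mem measurableSet_Ioc] with s hs
    rw [Real.norm_of_nonneg (mul_nonneg (h0 s hs.1) (h.bigPsi_pos hs.1).le), ← mul_assoc]
    exact mul_le_mul_of_nonneg_right (hM s hs.1) (h.bigPsi_pos hs.1).le
  right x hx := by
    refine ((h.greenIntegrable_r.right x hx).const_mul M).mono'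
      (((hF.mul h.continuousOn_bigPhi).mono (Ioi_subset_Ioi hx.le)).aestronglyMeasurable
        measurableSet_Ioi) ?_
    filter_upwards [ae_restrict_mem measurableSet_Ioi] with s hs
    have hs0 : 0 < s := hx.trans hs
    rw [Real.norm_of_nonneg (mul_nonneg (h0 s hs0) (h.bigPhi_pos hs0).le), ← mul_assoc]
    exact mul_le_mul_of_nonneg_right (hM s hs0) (h.bigPhi_pos hs0).le

theorem greenFun_nonneg (h : FundamentalPair b σ r φ ψ) (h0 : ∀ y, 0 < y → 0 ≤ F y) (hx : 0 < x) :
    0 ≤ greenFun b σ φ ψ F x := by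
  refine add_nonneg (mul_nonneg (h.dec.pos x hx).le ?_) (mul_nonneg (h.inc.pos x hx).le ?_)
  · exact setIntegral_nonneg measurableSet_Ioc fun s hs =>
      mul_nonneg (h0 s hs.1) (h.bigPsi_pos hs.1).le
  · exact setIntegral_nonneg measurableSet_Ioi fun s hs =>
      mul_nonneg (h0 s (hx.trans hs)) (h.bigPhi_pos (hx.trans hs)).le

theorem greenFun_const_mul_r_sub (h : FundamentalPair b σ r φ ψ)
    (hF : GreenIntegrable b σ φ ψ F) (M : ℝ) (hx : 0 < x) :
    greenFun b σ φ ψ (fun y => M * r y - F y) x = M - greenFun b σ φ ψ F x := by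
  have h1 := h.greenFun_r hx
  unfold greenFun at h1 ⊢
  simp only [sub_mul, mul_assoc]
  rw [integral_sub ((h.greenIntegrable_r.left x hx).const_mul M) (hF.left x hx),
    integral_sub ((h.greenIntegrable_r.right x hx).const_mul M) (hF.right x hx),
    integral_const_mul, integral_const_mul]
  linear_combination M * h1

/-- The contributions of the moving end points cancel because `φΨ = ψΦ`: the kernel is continuous on
the diagonal. -/
theorem hasDerivAt_greenFun (h : FundamentalPair b σ r φ ψ) (hF : GreenIntegrable b σ φ ψ F)
    (hx : 0 < x) : HasDerivAt (greenFun b σ φ ψ F) (greenDeriv b σ φ ψ F x) x := by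
  refine (((h.dec.hasDerivAt hx).mul (hasDerivAt_integral_Ioc
    (hF.continuousOn.mul h.continuousOn_bigPsi) hF.left hx)).add
    ((h.inc.hasDerivAt hx).mul (hasDerivAt_integral_Ioi
    (hF.continuousOn.mul h.continuousOn_bigPhi) hF.right hx))).congr_deriv ?_
  unfold greenDeriv
  simp only [Pi.mul_apply]
  linear_combination F x * dec_mul_bigPsi (b := b) (σ := σ) (φ := φ) (ψ := ψ) x

theorem hasDerivAt_greenDeriv (h : FundamentalPair b σ r φ ψ) (hF : GreenIntegrable b σ φ ψ F)
    (hx : 0 < x) : HasDerivAt (greenDeriv b σ φ ψ F)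
      (2 / σ x ^ 2 * (r x * greenFun b σ φ ψ F x - b x * greenDeriv b σ φ ψ F x - F x)) x := by
  refine (((h.dec.hasDerivAt_deriv hx).mul (hasDerivAt_integral_Ioc
    (hF.continuousOn.mul h.continuousOn_bigPsi) hF.left hx)).add
    ((h.inc.hasDerivAt_deriv hx).mul (hasDerivAt_integral_Ioi
    (hF.continuousOn.mul h.continuousOn_bigPhi) hF.right hx))).congr_deriv ?_
  rw [h.dec.deriv_deriv_eq (h.σ_pos x hx) hx, h.inc.deriv_deriv_eq (h.σ_pos x hx) hx]
  simp only [greenDeriv, greenFun, Pi.mul_apply]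
  linear_combination F x * h.deriv_mul_bigPsi_sub hx

theorem deriv_greenFun (h : FundamentalPair b σ r φ ψ) (hF : GreenIntegrable b σ φ ψ F)
    (hx : 0 < x) : deriv (greenFun b σ φ ψ F) x = greenDeriv b σ φ ψ F x :=
  (h.hasDerivAt_greenFun hF hx).deriv

theorem deriv_deriv_greenFun (h : FundamentalPair b σ r φ ψ) (hF : GreenIntegrable b σ φ ψ F)
    (hx : 0 < x) : deriv (deriv (greenFun b σ φ ψ F)) x =
      2 / σ x ^ 2 * (r x * greenFun b σ φ ψ F x - b x * greenDeriv b σ φ ψ F x - F x) := by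
  rw [← (h.hasDerivAt_greenDeriv hF hx).deriv]
  refine EventuallyEq.deriv_eq ?_
  filter_upwards [Ioi_mem_nhds hx] with y hy
  exact h.deriv_greenFun hF hy

theorem discountedGenerator_greenFun (h : FundamentalPair b σ r φ ψ)
    (hF : GreenIntegrable b σ φ ψ F) (hx : 0 < x) :
    discountedGenerator b σ r (greenFun b σ φ ψ F) x = -F x := by
  have := (h.σ_pos x hx).ne'
  rw [discountedGenerator, generator, h.deriv_deriv_greenFun hF hx, h.deriv_greenFun hF hx]
  field_simp
  ring

theorem contDiffOn_greenFun (h : FundamentalPair b σ r φ ψ) (hF : GreenIntegrable b σ φ ψ F) :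
    ContDiffOn ℝ 2 (greenFun b σ φ ψ F) (Ioi 0) := by
  rw [show (2 : WithTop ℕ∞) = 1 + 1 by norm_num, contDiffOn_succ_iff_deriv_of_isOpen isOpen_Ioi]
  refine ⟨fun x hx => (h.hasDerivAt_greenFun hF hx).differentiableAt.differentiableWithinAt,
    by simp, ?_⟩
  refine ContDiffOn.congr ?_ fun x hx => h.deriv_greenFun hF hx
  rw [show (1 : WithTop ℕ∞) = 0 + 1 by norm_num, contDiffOn_succ_iff_deriv_of_isOpen isOpen_Ioi]
  refine ⟨fun x hx => (h.hasDerivAt_greenDeriv hF hx).differentiableAt.differentiableWithinAt,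
    by simp, contDiffOn_zero.2 ?_⟩
  refine ContinuousOn.congr ?_ fun x hx => (h.hasDerivAt_greenDeriv hF hx).deriv
  have h1 : ContinuousOn (greenFun b σ φ ψ F) (Ioi 0) := fun x hx =>
    (h.hasDerivAt_greenFun hF hx).continuousAt.continuousWithinAt
  have h2 : ContinuousOn (greenDeriv b σ φ ψ F) (Ioi 0) := fun x hx =>
    (h.hasDerivAt_greenDeriv hF hx).continuousAt.continuousWithinAt
  exact (continuousOn_const.div (h.continuousOn_σ.pow 2)
    fun x hx => (pow_pos (h.σ_pos x hx) 2).ne').mul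
    (((h.continuousOn_r.mul h1).sub (h.continuousOn_b.mul h2)).sub hF.continuousOn)

end FundamentalPair

/-! ### The discounted martingale problem -/

/-- Integration by parts for `e^{-Λ} f` along a path. -/
theorem exp_neg_integral_mul_sub_integral {R a f : ℝ → ℝ} (hR : Continuous R) (ha : Continuous a)
    (hf : Continuous f) (t : ℝ) :
    Real.exp (-∫ s in (0 : ℝ)..t, R s) * f t
        - ∫ s in (0 : ℝ)..t, Real.exp (-∫ u in (0 : ℝ)..s, R u) * (a s - R s * f s)
      = (f t - ∫ s in (0 : ℝ)..t, a s) - ∫ s in (0 : ℝ)..t,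
        R s * Real.exp (-∫ u in (0 : ℝ)..s, R u) *
          ((f t - ∫ s in (0 : ℝ)..t, a s) - (f s - ∫ u in (0 : ℝ)..s, a u)) := by
  set L : ℝ → ℝ := fun t => ∫ s in (0 : ℝ)..t, R s with hL
  set A : ℝ → ℝ := fun t => ∫ s in (0 : ℝ)..t, a s with hA
  have hLd : ∀ s, HasDerivAt L (R s) s := fun s => hR.integral_hasStrictDerivAt 0 s |>.hasDerivAt
  have hAd : ∀ s, HasDerivAt A (a s) s := fun s => ha.integral_hasStrictDerivAt 0 s |>.hasDerivAt
  have hLc : Continuous L := continuous_iff_continuousAt.2 fun s => (hLd s).continuousAt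
  have hAc : Continuous A := continuous_iff_continuousAt.2 fun s => (hAd s).continuousAt
  have hEd : ∀ s, HasDerivAt (fun s => Real.exp (-L s)) (Real.exp (-L s) * -R s) s :=
    fun s => (hLd s).neg.exp
  have e1 := intervalIntegral.integral_eq_sub_of_hasDerivAt (a := 0) (b := t) (fun s _ => hEd s)
    (Continuous.intervalIntegrable (by fun_prop) _ _)
  have e2 := intervalIntegral.integral_eq_sub_of_hasDerivAt (a := 0) (b := t)
    (fun s _ => (hEd s).fun_mul (hAd s)) (Continuous.intervalIntegrable (by fun_prop) _ _)
  have hA0 : A 0 = 0 := by simp [hA]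
  have hL0 : L 0 = 0 := by simp [hL]
  rw [hA0, mul_zero, sub_zero] at e2
  rw [hL0, neg_zero, Real.exp_zero] at e1
  change Real.exp (-L t) * f t - (∫ s in (0 : ℝ)..t, Real.exp (-L s) * (a s - R s * f s))
    = (f t - A t) - ∫ s in (0 : ℝ)..t, R s * Real.exp (-L s) * ((f t - A t) - (f s - A s))
  -- The three pieces are the derivative of `e^{-L}A`, the weighted increments of `f - A`, and a
  -- multiple of the derivative of `e^{-L}`; the first and last integrate explicitly.
  have e3 : (∫ s in (0 : ℝ)..t, Real.exp (-L s) * (a s - R s * f s))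
      = (∫ s in (0 : ℝ)..t, Real.exp (-L s) * -R s * A s + Real.exp (-L s) * a s)
        + (∫ s in (0 : ℝ)..t, R s * Real.exp (-L s) * ((f t - A t) - (f s - A s)))
        + (f t - A t) * ∫ s in (0 : ℝ)..t, Real.exp (-L s) * -R s := by
    rw [← intervalIntegral.integral_const_mul, ← intervalIntegral.integral_add,
      ← intervalIntegral.integral_add]
    · refine intervalIntegral.integral_congr fun s _ => ?_
      ring
    all_goals exact Continuous.intervalIntegrable (by fun_prop) _ _
  rw [e3, e1, e2]
  ring

section Measurability

variable {Ω : Type*} {m : MeasurableSpace Ω}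

theorem stronglyMeasurable_uncurry_of_continuous {u : ℝ → Ω → ℝ}
    (hc : ∀ ω, Continuous fun t => u t ω) (hm : ∀ t, StronglyMeasurable (u t)) :
    StronglyMeasurable (Function.uncurry u) :=
  stronglyMeasurable_uncurry_of_continuous_of_stronglyMeasurable hc hm

theorem stronglyMeasurable_intervalIntegral {u : ℝ → Ω → ℝ}
    (hc : ∀ ω, Continuous fun t => u t ω) (hm : ∀ t, StronglyMeasurable (u t)) (a b : ℝ) :
    StronglyMeasurable fun ω => ∫ s in a..b, u s ω := by
  have := stronglyMeasurable_uncurry_of_continuous hc hm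
  unfold intervalIntegral
  exact (StronglyMeasurable.integral_prod_left (μ := volume.restrict (Ioc a b)) this).sub
    (StronglyMeasurable.integral_prod_left (μ := volume.restrict (Ioc b a)) this)

end Measurability

namespace IsDiffusion

variable {Ω : Type*} [mΩ : MeasurableSpace Ω] {P : Measure Ω}
  {ℱ : Filtration ℝ≥0 mΩ} {b σ r g : ℝ → ℝ} {x : ℝ} {Y : ℝ≥0 → Ω → ℝ}

theorem stronglyMeasurable_comp_filtration (hY : IsDiffusion b σ P ℱ x Y)
    (hg : ContinuousOn g (Ioi 0)) (t : ℝ≥0) : StronglyMeasurable[ℱ t] fun ω => g (Y t ω) := by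
  -- Nothing is known about `g` off the half line, so it is cut off there; the paths never leave
  -- `]0, ∞[`.
  have h1 : Measurable ((Ioi (0 : ℝ)).indicator g) := by
    classical
    rw [← piecewise_eq_indicator]
    exact hg.measurable_piecewise continuousOn_const measurableSet_Ioi
  have h2 := h1.comp (hY.adapted t).measurable
  have h3 : (fun ω => g (Y t ω)) = (Ioi (0 : ℝ)).indicator g ∘ Y t := by
    ext ω
    exact (indicator_of_mem (mem_Ioi.2 (hY.pos t ω)) g).symm
  rw [h3]
  exact Measurable.stronglyMeasurable h2

theorem stronglyMeasurable_comp (hY : IsDiffusion b σ P ℱ x Y)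
    (hg : ContinuousOn g (Ioi 0)) (t : ℝ≥0) : StronglyMeasurable fun ω => g (Y t ω) :=
  (hY.stronglyMeasurable_comp_filtration hg t).mono (ℱ.le t)

theorem continuous_comp (hY : IsDiffusion b σ P ℱ x Y) (hg : ContinuousOn g (Ioi 0)) (ω : Ω) :
    Continuous fun t : ℝ => g (Y t.toNNReal ω) :=
  hg.comp_continuous ((hY.continuous ω).comp continuous_real_toNNReal) fun _ => hY.pos _ ω

theorem stronglyMeasurable_uncurry_comp (hY : IsDiffusion b σ P ℱ x Y)
    (hg : ContinuousOn g (Ioi 0)) :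
    StronglyMeasurable (Function.uncurry fun (t : ℝ) ω => g (Y t.toNNReal ω)) :=
  stronglyMeasurable_uncurry_of_continuous (hY.continuous_comp hg)
    fun _ => hY.stronglyMeasurable_comp hg _

theorem hasDerivAt_discount (hY : IsDiffusion b σ P ℱ x Y) (hr : ContinuousOn r (Ioi 0)) (t : ℝ)
    (ω : Ω) : HasDerivAt (fun t => discount r Y t ω) (r (Y t.toNNReal ω)) t :=
  ((hY.continuous_comp hr ω).integral_hasStrictDerivAt 0 t).hasDerivAt

theorem continuous_discount (hY : IsDiffusion b σ P ℱ x Y) (hr : ContinuousOn r (Ioi 0)) (ω : Ω) :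
    Continuous fun t => discount r Y t ω :=
  continuous_iff_continuousAt.2 fun t => (hY.hasDerivAt_discount hr t ω).continuousAt

theorem stronglyMeasurable_discount_filtration (hY : IsDiffusion b σ P ℱ x Y)
    (hr : ContinuousOn r (Ioi 0)) {t : ℝ} (ht : 0 ≤ t) :
    StronglyMeasurable[ℱ t.toNNReal] fun ω => discount r Y t ω := by
  -- Stopping the clock at `t` makes the integrand measurable for `ℱ t` at every real `s`, not only
  -- on the range of integration.
  have h1 : (fun ω => discount r Y t ω)
      = fun ω => ∫ s in (0 : ℝ)..t, r (Y (min s t).toNNReal ω) := by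
    ext ω
    refine intervalIntegral.integral_congr fun s hs => ?_
    rw [uIcc_of_le ht] at hs
    simp only [min_eq_left hs.2]
  rw [h1]
  refine stronglyMeasurable_intervalIntegral (m := ℱ t.toNNReal)
    (fun ω => (hY.continuous_comp hr ω).comp (by fun_prop)) (fun s => ?_) 0 t
  exact (hY.stronglyMeasurable_comp_filtration hr _).mono
    (ℱ.mono (Real.toNNReal_le_toNNReal (min_le_right s t)))

theorem stronglyMeasurable_discount (hY : IsDiffusion b σ P ℱ x Y)
    (hr : ContinuousOn r (Ioi 0)) (t : ℝ) : StronglyMeasurable fun ω => discount r Y t ω :=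
  stronglyMeasurable_intervalIntegral (hY.continuous_comp hr)
    (fun _ => hY.stronglyMeasurable_comp hr _) 0 t

theorem stronglyMeasurable_exp_mul (hY : IsDiffusion b σ P ℱ x Y) (hr : ContinuousOn r (Ioi 0))
    (hg : ContinuousOn g (Ioi 0)) : StronglyMeasurable (Function.uncurry fun (t : ℝ) ω =>
      Real.exp (-discount r Y t ω) * g (Y t.toNNReal ω)) :=
  stronglyMeasurable_uncurry_of_continuous
    (fun ω => (hY.continuous_discount hr ω).neg.rexp.mul (hY.continuous_comp hg ω))
    fun t => (Real.continuous_exp.comp_stronglyMeasurable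
      (hY.stronglyMeasurable_discount hr t).neg).mul (hY.stronglyMeasurable_comp hg _)

theorem mul_le_discount (hY : IsDiffusion b σ P ℱ x Y) (hr : ContinuousOn r (Ioi 0)) {r₀ : ℝ}
    (hr₀ : ∀ y, 0 < y → r₀ ≤ r y) {t : ℝ} (ht : 0 ≤ t) (ω : Ω) :
    r₀ * t ≤ discount r Y t ω := by
  have := intervalIntegral.integral_mono_on ht
    (intervalIntegrable_const (μ := volume) (c := r₀))
    ((hY.continuous_comp hr ω).intervalIntegrable 0 t) fun s _ => hr₀ _ (hY.pos s.toNNReal ω)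
  simpa [mul_comm, discount] using this

theorem exp_neg_discount_le (hY : IsDiffusion b σ P ℱ x Y) (hr : ContinuousOn r (Ioi 0)) {r₀ : ℝ}
    (hr₀ : ∀ y, 0 < y → r₀ ≤ r y) {t : ℝ} (ht : 0 ≤ t) (ω : Ω) :
    Real.exp (-discount r Y t ω) ≤ Real.exp (-r₀ * t) := by
  have := hY.mul_le_discount hr hr₀ ht ω
  exact Real.exp_le_exp.2 (by linarith)

theorem integral_mul_eq_of_stronglyMeasurable [IsProbabilityMeasure P]
    {M : ℝ≥0 → Ω → ℝ} (hM : Martingale M ℱ P) {s t : ℝ≥0} (hst : s ≤ t) {ρ : Ω → ℝ}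
    (hρ : StronglyMeasurable[ℱ s] ρ) {K : ℝ} (hK : ∀ ω, |ρ ω| ≤ K) :
    ∫ ω, ρ ω * M t ω ∂P = ∫ ω, ρ ω * M s ω ∂P := by
  have h1 := condExp_stronglyMeasurable_mul_of_bound (ℱ.le s) hρ (hM.integrable t) K
    (Eventually.of_forall hK)
  rw [← integral_condExp (ℱ.le s)]
  refine integral_congr_ae ?_
  filter_upwards [h1, hM.condExp_ae_eq hst] with ω e1 e2
  have e3 : (P[ρ * M t | ℱ s]) ω = (P[fun ω => ρ ω * M t ω | ℱ s]) ω := rfl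
  rw [← e3, e1, Pi.mul_apply, e2]

/-- Dynkin's formula with discounting. -/
theorem integral_exp_mul_sub [IsProbabilityMeasure P] (hY : IsDiffusion b σ P ℱ x Y)
    (hr : ContinuousOn r (Ioi 0)) (hr₀ : ∀ y, 0 < y → 0 ≤ r y) {K : ℝ}
    (hK : ∀ y, 0 < y → r y ≤ K) {f : ℝ → ℝ} (hf : ContDiff ℝ 2 f) (hfc : HasCompactSupport f)
    (hfs : tsupport f ⊆ Ioi 0) (hA : ContinuousOn (generator b σ f) (Ioi 0)) {B : ℝ}
    (hB : ∀ y, 0 < y → |generator b σ f y| ≤ B) {t : ℝ} (ht : 0 ≤ t) :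
    ∫ ω, (Real.exp (-discount r Y t ω) * f (Y t.toNNReal ω)
      - ∫ s in (0 : ℝ)..t, Real.exp (-discount r Y s ω) *
        discountedGenerator b σ r f (Y s.toNNReal ω)) ∂P = f x := by
  have hmart := hY.martingale f hf hfc hfs
  set M : ℝ → Ω → ℝ := fun t ω =>
    f (Y t.toNNReal ω) - ∫ s in (0 : ℝ)..t, generator b σ f (Y s.toNNReal ω) with hMdef
  have hMN : ∀ s, 0 ≤ s → M s = fun ω => f (Y s.toNNReal ω) - ∫ u in (0 : ℝ)..(s.toNNReal : ℝ),
      generator b σ f (Y u.toNNReal ω) := fun s hs => by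
    simp only [hMdef, Real.coe_toNNReal s hs]
  have hfcont : ContinuousOn f (Ioi 0) := hf.continuous.continuousOn
  obtain ⟨Bf, hBf⟩ := hfc.exists_bound_of_continuous hf.continuous
  have hMc : ∀ ω, Continuous fun s => M s ω := fun ω =>
    (hY.continuous_comp hfcont ω).sub (continuous_iff_continuousAt.2 fun s =>
      ((hY.continuous_comp hA ω).integral_hasStrictDerivAt 0 s).hasDerivAt.continuousAt)
  have hMm : ∀ s, StronglyMeasurable (M s) := fun s =>
    (hY.stronglyMeasurable_comp hfcont _).sub (stronglyMeasurable_intervalIntegral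
      (hY.continuous_comp hA) (fun _ => hY.stronglyMeasurable_comp hA _) 0 s)
  have hMb : ∀ s ∈ Icc 0 t, ∀ ω, |M s ω| ≤ Bf + B * t := by
    intro s hs ω
    have h1 : |f (Y s.toNNReal ω)| ≤ Bf := hBf _
    have h2 : ‖∫ u in (0 : ℝ)..s, generator b σ f (Y u.toNNReal ω)‖ ≤ B * |s - 0| :=
      intervalIntegral.norm_integral_le_of_norm_le_const fun u _ => hB _ (hY.pos _ ω)
    rw [sub_zero, abs_of_nonneg hs.1, Real.norm_eq_abs] at h2
    have hB0 : 0 ≤ B := (abs_nonneg _).trans (hB 1 one_pos)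
    calc |M s ω| ≤ |f (Y s.toNNReal ω)| + |∫ u in (0 : ℝ)..s, generator b σ f (Y u.toNNReal ω)| :=
          abs_sub _ _
      _ ≤ Bf + B * s := add_le_add h1 h2
      _ ≤ Bf + B * t := by gcongr; exact hs.2
  set ρ : ℝ → Ω → ℝ := fun s ω => r (Y s.toNNReal ω) * Real.exp (-discount r Y s ω) with hρdef
  have hρc : ∀ ω, Continuous fun s => ρ s ω := fun ω =>
    (hY.continuous_comp hr ω).mul (hY.continuous_discount hr ω).neg.rexp
  have hρF : ∀ s, 0 ≤ s → StronglyMeasurable[ℱ s.toNNReal] (ρ s) := fun s hs =>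
    (hY.stronglyMeasurable_comp_filtration hr _).mul (Real.continuous_exp.comp_stronglyMeasurable
      (hY.stronglyMeasurable_discount_filtration hr hs).neg)
  have hρm : ∀ s, StronglyMeasurable (ρ s) := fun s =>
    (hY.stronglyMeasurable_comp hr _).mul (Real.continuous_exp.comp_stronglyMeasurable
      (hY.stronglyMeasurable_discount hr s).neg)
  have hρb : ∀ s, 0 ≤ s → ∀ ω, |ρ s ω| ≤ K := by
    intro s hs ω
    have h1 := hY.exp_neg_discount_le hr hr₀ hs ω
    rw [neg_zero, zero_mul, Real.exp_zero] at h1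
    have h2 := hr₀ _ (hY.pos s.toNNReal ω)
    have h3 := hK _ (hY.pos s.toNNReal ω)
    rw [abs_of_nonneg (mul_nonneg h2 (Real.exp_pos _).le)]
    nlinarith [Real.exp_pos (-discount r Y s ω)]
  have hK0 : 0 ≤ K := (hr₀ 1 one_pos).trans (hK 1 one_pos)
  have hjoint : ∀ N : ℝ → Ω → ℝ, (∀ ω, Continuous fun s => N s ω) →
      (∀ s, StronglyMeasurable (N s)) → (∀ s ∈ Icc 0 t, ∀ ω, |N s ω| ≤ Bf + B * t) →
      Integrable (Function.uncurry fun s ω => ρ s ω * N s ω)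
        ((volume.restrict (Ioc 0 t)).prod P) := by
    intro N hc hm hb
    refine Integrable.of_bound (C := K * (Bf + B * t)) (stronglyMeasurable_uncurry_of_continuous
      (fun ω => (hρc ω).mul (hc ω)) fun s => (hρm s).mul (hm s)).aestronglyMeasurable ?_
    have : ∀ᵐ p ∂((volume.restrict (Ioc 0 t)).prod P), p.1 ∈ Ioc 0 t :=
      Measure.quasiMeasurePreserving_fst.ae (ae_restrict_mem measurableSet_Ioc)
    filter_upwards [this] with p hp
    rw [Function.uncurry, Real.norm_eq_abs, abs_mul]
    exact mul_le_mul (hρb _ hp.1.le _) (hb _ (Ioc_subset_Icc_self hp) _) (abs_nonneg _) hK0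
  have hI1 := hjoint (fun _ => M t) (fun _ => continuous_const) (fun _ => hMm t)
    (fun _ _ => hMb t (right_mem_Icc.2 ht))
  have hI2 := hjoint M hMc hMm hMb
  have hswap : ∀ N : ℝ → Ω → ℝ, Integrable (Function.uncurry fun s ω => ρ s ω * N s ω)
        ((volume.restrict (Ioc 0 t)).prod P) →
      ∫ ω, (∫ s in (0 : ℝ)..t, ρ s ω * N s ω) ∂P = ∫ s in Ioc 0 t, ∫ ω, ρ s ω * N s ω ∂P := by
    intro N hN
    simp only [intervalIntegral.integral_of_le ht]
    exact (integral_integral_swap hN).symm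
  -- After Fubini, for each fixed `s` the increment `M t - M s` is orthogonal to the bounded `ℱ
  -- s`-measurable weight `ρ s`. This replaces stochastic integration by parts.
  have hmid : ∫ ω, (∫ s in (0 : ℝ)..t, ρ s ω * M t ω) ∂P
      = ∫ ω, (∫ s in (0 : ℝ)..t, ρ s ω * M s ω) ∂P := by
    rw [hswap (fun _ => M t) hI1, hswap M hI2]
    refine setIntegral_congr_fun measurableSet_Ioc fun s hs => ?_
    rw [hMN t ht, hMN s hs.1.le]
    exact integral_mul_eq_of_stronglyMeasurable hmart (Real.toNNReal_le_toNNReal hs.2)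
      (hρF s hs.1.le) (hρb s hs.1.le)
  have hJ : ∀ N : ℝ → Ω → ℝ, Integrable (Function.uncurry fun s ω => ρ s ω * N s ω)
        ((volume.restrict (Ioc 0 t)).prod P) →
      Integrable (fun ω => ∫ s in (0 : ℝ)..t, ρ s ω * N s ω) P := by
    intro N hN
    simp only [intervalIntegral.integral_of_le ht]
    exact hN.integral_prod_right
  have hMt : Integrable (M t) P := by
    rw [hMN t ht]
    exact hmart.integrable _
  have hpath : ∀ ω, (Real.exp (-discount r Y t ω) * f (Y t.toNNReal ω)
      - ∫ s in (0 : ℝ)..t, Real.exp (-discount r Y s ω) *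
        discountedGenerator b σ r f (Y s.toNNReal ω))
      = M t ω - ((∫ s in (0 : ℝ)..t, ρ s ω * M t ω) - ∫ s in (0 : ℝ)..t, ρ s ω * M s ω) := by
    intro ω
    have i1 : IntervalIntegrable (fun s => ρ s ω * M t ω) volume 0 t :=
      ((hρc ω).mul continuous_const).intervalIntegrable _ _
    have i2 : IntervalIntegrable (fun s => ρ s ω * M s ω) volume 0 t :=
      ((hρc ω).mul (hMc ω)).intervalIntegrable _ _
    rw [← intervalIntegral.integral_sub i1 i2]
    simp only [← mul_sub]
    exact exp_neg_integral_mul_sub_integral (hY.continuous_comp hr ω) (hY.continuous_comp hA ω)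
      (hY.continuous_comp hfcont ω) t
  simp only [hpath]
  have i3 : Integrable (fun ω => (∫ s in (0 : ℝ)..t, ρ s ω * M t ω)
      - ∫ s in (0 : ℝ)..t, ρ s ω * M s ω) P := (hJ _ hI1).sub (hJ _ hI2)
  rw [integral_sub hMt i3, integral_sub (hJ _ hI1) (hJ _ hI2), hmid,
    sub_self, sub_zero]
  have h0 := integral_mul_eq_of_stronglyMeasurable hmart (zero_le (a := t.toNNReal))
    (ρ := fun _ => 1) stronglyMeasurable_const (K := 1) (by simp)
  simp only [one_mul] at h0
  rw [hMN t ht, h0]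
  simp [hY.start]

end IsDiffusion

/-! ### The discounted occupation measure -/

/-- The discounted occupation measure `A ↦ E[∫₀^∞ e^{-Λ_t} 1_A(Y_t) dt]`. -/
noncomputable def occupationMeasure {Ω : Type*} [MeasurableSpace Ω] (r : ℝ → ℝ) (P : Measure Ω)
    (Y : ℝ≥0 → Ω → ℝ) : Measure ℝ :=
  Measure.map (fun p : ℝ × Ω => Y p.1.toNNReal p.2)
    (((volume.restrict (Ioi 0)).prod P).withDensity
      fun p => (Real.exp (-discount r Y p.1 p.2)).toNNReal)

theorem support_generator_subset (b σ f : ℝ → ℝ) :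
    Function.support (generator b σ f) ⊆ tsupport f := by
  intro y hy
  by_contra hn
  have h1 : deriv f y = 0 := by
    by_contra h
    exact hn (support_deriv_subset h)
  have h2 : deriv (deriv f) y = 0 := by
    by_contra h
    exact hn (closure_minimal support_deriv_subset (isClosed_tsupport f) (support_deriv_subset h))
  exact hy (by simp [generator, h1, h2])

theorem exists_bound_of_support_subset {f g : ℝ → ℝ} (hg : ContinuousOn g (Ioi 0))
    (hfc : HasCompactSupport f) (hfs : tsupport f ⊆ Ioi 0)
    (hgf : Function.support g ⊆ tsupport f) : ∃ B, ∀ y, |g y| ≤ B := by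
  obtain ⟨B, hB⟩ := IsCompact.exists_bound_of_continuousOn hfc (hg.mono hfs)
  refine ⟨max B 0, fun y => ?_⟩
  by_cases hy : y ∈ tsupport f
  · exact (hB y hy).trans (le_max_left _ _)
  · have : g y = 0 := by
      by_contra h
      exact hy (hgf h)
    simp [this]

theorem continuousOn_generator {b σ f : ℝ → ℝ} (hb : ContinuousOn b (Ioi 0))
    (hσ : ContinuousOn σ (Ioi 0)) (hf : ContDiff ℝ 2 f) :
    ContinuousOn (generator b σ f) (Ioi 0) := by
  have h1 : ContDiff ℝ 1 (deriv f) := by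
    have : ContDiff ℝ (1 + 1) f := by norm_num; exact hf
    exact (contDiff_succ_iff_deriv.1 this).2.2
  have h2 : Continuous (deriv (deriv f)) := h1.continuous_deriv le_rfl
  exact ((continuousOn_const.mul (hσ.pow 2)).mul h2.continuousOn).add
    (hb.mul h1.continuous.continuousOn)

theorem integrable_iff_integrable_uncurry_swap {α β : Type*} [MeasurableSpace α]
    [MeasurableSpace β] {μ : Measure α} {ν : Measure β} [SFinite μ] [SFinite ν] {u : α → β → ℝ}
    (hu : AEStronglyMeasurable (Function.uncurry u) (μ.prod ν))
    (h : ∫⁻ y, ∫⁻ x, ENNReal.ofReal |u x y| ∂μ ∂ν < ⊤) :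
    Integrable (Function.uncurry u) (μ.prod ν) := by
  refine ⟨hu, ?_⟩
  rw [hasFiniteIntegral_iff_norm]
  rw [lintegral_prod_symm _ hu.norm.aemeasurable.ennreal_ofReal]
  exact h

namespace IsDiffusion

variable {Ω : Type*} [mΩ : MeasurableSpace Ω] {P : Measure Ω}
  {ℱ : Filtration ℝ≥0 mΩ} {b σ r g : ℝ → ℝ} {x : ℝ} {Y : ℝ≥0 → Ω → ℝ}

theorem measurable_path (hY : IsDiffusion b σ P ℱ x Y) :
    Measurable fun p : ℝ × Ω => Y p.1.toNNReal p.2 :=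
  (hY.stronglyMeasurable_uncurry_comp (g := id) continuousOn_id).measurable

theorem measurable_density (hY : IsDiffusion b σ P ℱ x Y) (hr : ContinuousOn r (Ioi 0)) :
    Measurable fun p : ℝ × Ω => (Real.exp (-discount r Y p.1 p.2)).toNNReal := by
  have := (hY.stronglyMeasurable_exp_mul hr (g := fun _ => 1) continuousOn_const).measurable
  simp only [mul_one] at this
  exact this.real_toNNReal

theorem ae_mem_Ioi (hY : IsDiffusion b σ P ℱ x Y) :
    ∀ᵐ y ∂occupationMeasure r P Y, y ∈ Ioi (0 : ℝ) := by
  exact (ae_map_iff (p := fun y => y ∈ Ioi (0 : ℝ)) hY.measurable_path.aemeasurable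
    measurableSet_Ioi).2 (Eventually.of_forall fun p => hY.pos _ _)

theorem aestronglyMeasurable_occupationMeasure (hY : IsDiffusion b σ P ℱ x Y)
    (hg : ContinuousOn g (Ioi 0)) : AEStronglyMeasurable g (occupationMeasure r P Y) := by
  have : (occupationMeasure r P Y).restrict (Ioi 0) = occupationMeasure r P Y :=
    Measure.restrict_eq_self_of_ae_mem hY.ae_mem_Ioi
  rw [← this]
  exact hg.aestronglyMeasurable measurableSet_Ioi

theorem integrable_occupationMeasure_iff [SFinite P] (hY : IsDiffusion b σ P ℱ x Y)
    (hr : ContinuousOn r (Ioi 0)) (hg : ContinuousOn g (Ioi 0)) :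
    Integrable g (occupationMeasure r P Y) ↔ Integrable (Function.uncurry fun (t : ℝ) ω =>
      Real.exp (-discount r Y t ω) * g (Y t.toNNReal ω)) ((volume.restrict (Ioi 0)).prod P) := by
  rw [occupationMeasure, integrable_map_measure (hY.aestronglyMeasurable_occupationMeasure hg)
    hY.measurable_path.aemeasurable, integrable_withDensity_iff_integrable_smul
    (hY.measurable_density hr)]
  refine integrable_congr (Eventually.of_forall fun p => ?_)
  simp [NNReal.smul_def, Function.uncurry, (Real.exp_pos _).le]

theorem integral_occupationMeasure [SFinite P] (hY : IsDiffusion b σ P ℱ x Y)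
    (hr : ContinuousOn r (Ioi 0)) (hg : ContinuousOn g (Ioi 0))
    (hi : Integrable g (occupationMeasure r P Y)) :
    ∫ y, g y ∂occupationMeasure r P Y =
      ∫ ω, (∫ t in Ioi (0 : ℝ), Real.exp (-discount r Y t ω) * g (Y t.toNNReal ω)) ∂P := by
  rw [hY.integrable_occupationMeasure_iff hr hg] at hi
  have h1 := integral_prod_symm _ hi
  simp only [Function.uncurry] at h1
  rw [← h1, occupationMeasure, integral_map hY.measurable_path.aemeasurable
    (hY.aestronglyMeasurable_occupationMeasure hg),
    integral_withDensity_eq_integral_smul (hY.measurable_density hr)]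
  refine integral_congr_ae (Eventually.of_forall fun p => ?_)
  simp [NNReal.smul_def, (Real.exp_pos _).le]

theorem integrable_of_finiteDiscountedIntegral [SFinite P] (hY : IsDiffusion b σ P ℱ x Y)
    (hr : ContinuousOn r (Ioi 0)) (hg : ContinuousOn g (Ioi 0))
    (h : FiniteDiscountedIntegral r P Y g) : Integrable g (occupationMeasure r P Y) := by
  rw [hY.integrable_occupationMeasure_iff hr hg]
  refine integrable_iff_integrable_uncurry_swap
    (hY.stronglyMeasurable_exp_mul hr hg).aestronglyMeasurable ?_
  simpa only [FiniteDiscountedIntegral, abs_mul, abs_of_pos (Real.exp_pos _)] using h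

theorem tendsto_exp_neg_discount (hY : IsDiffusion b σ P ℱ x Y)
    (hr : ContinuousOn r (Ioi 0)) {r₀ : ℝ} (hr0 : 0 < r₀) (hr₀ : ∀ y, 0 < y → r₀ ≤ r y) (ω : Ω) :
    Tendsto (fun t => Real.exp (-discount r Y t ω)) atTop (𝓝 0) := by
  refine Real.tendsto_exp_neg_atTop_nhds_zero.comp (tendsto_atTop_mono' _ ?_
    (tendsto_id.const_mul_atTop hr0))
  filter_upwards [eventually_ge_atTop 0] with t ht
  exact hY.mul_le_discount hr hr₀ ht ω

variable [IsProbabilityMeasure P] {r₀ : ℝ}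

theorem integrable_occupationMeasure_of_bound (hY : IsDiffusion b σ P ℱ x Y)
    (hr : ContinuousOn r (Ioi 0)) (hr0 : 0 < r₀) (hr₀ : ∀ y, 0 < y → r₀ ≤ r y)
    (hg : ContinuousOn g (Ioi 0)) {K : ℝ} (hK : ∀ y, 0 < y → |g y| ≤ K) :
    Integrable g (occupationMeasure r P Y) := by
  rw [hY.integrable_occupationMeasure_iff hr hg]
  have h1 : Integrable (fun p : ℝ × Ω => Real.exp (-r₀ * p.1) * K)
      ((volume.restrict (Ioi 0)).prod P) :=
    (integrableOn_exp_mul_Ioi (by linarith : -r₀ < 0) 0).integrable.mul_prod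
      (integrable_const (μ := P) K)
  refine h1.mono' (hY.stronglyMeasurable_exp_mul hr hg).aestronglyMeasurable ?_
  have : ∀ᵐ p ∂((volume.restrict (Ioi 0)).prod P), p.1 ∈ Ioi (0 : ℝ) :=
    Measure.quasiMeasurePreserving_fst.ae (ae_restrict_mem measurableSet_Ioi)
  filter_upwards [this] with p hp
  rw [Function.uncurry, norm_mul, Real.norm_of_nonneg (Real.exp_pos _).le]
  exact mul_le_mul (hY.exp_neg_discount_le hr hr₀ (le_of_lt hp) _) (hK _ (hY.pos _ _))
    (norm_nonneg _) (Real.exp_pos _).le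

theorem isFiniteMeasure_occupationMeasure (hY : IsDiffusion b σ P ℱ x Y)
    (hr : ContinuousOn r (Ioi 0)) (hr0 : 0 < r₀) (hr₀ : ∀ y, 0 < y → r₀ ≤ r y) :
    IsFiniteMeasure (occupationMeasure r P Y) := by
  have := hY.integrable_occupationMeasure_of_bound hr hr0 hr₀ (g := fun _ => 1)
    continuousOn_const (K := 1) (by simp)
  exact (integrable_const_iff_isFiniteMeasure one_ne_zero).1 this

/-- Along every path `r e^{-Λ}` is the derivative of `-e^{-Λ}`, and `Λ → ∞` since `r ≥ r₀ > 0`. -/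
theorem integral_rate_occupationMeasure (hY : IsDiffusion b σ P ℱ x Y)
    (hr : ContinuousOn r (Ioi 0)) (hr0 : 0 < r₀) (hr₀ : ∀ y, 0 < y → r₀ ≤ r y)
    {K : ℝ} (hK : ∀ y, 0 < y → r y ≤ K) : ∫ y, r y ∂occupationMeasure r P Y = 1 := by
  have hnn : ∀ y, 0 < y → 0 ≤ r y := fun y hy => hr0.le.trans (hr₀ y hy)
  rw [hY.integral_occupationMeasure hr hr (hY.integrable_occupationMeasure_of_bound hr hr0 hr₀ hr
    (K := K) fun y hy => by rw [abs_of_nonneg (hnn y hy)]; exact hK y hy)]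
  have h1 : ∀ ω, ∫ t in Ioi (0 : ℝ), Real.exp (-discount r Y t ω) * r (Y t.toNNReal ω) = 1 := by
    intro ω
    have := integral_Ioi_of_hasDerivAt_of_nonneg' (a := 0) (l := 0)
      (g := fun t => -Real.exp (-discount r Y t ω))
      (g' := fun t => Real.exp (-discount r Y t ω) * r (Y t.toNNReal ω))
      (fun t _ => by simpa using (hY.hasDerivAt_discount hr t ω).fun_neg.exp.fun_neg)
      (fun t _ => mul_nonneg (Real.exp_pos _).le (hnn _ (hY.pos _ _)))
      (by simpa using (hY.tendsto_exp_neg_discount hr hr0 hr₀ ω).neg)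
    rw [this]
    simp [discount]
  simp [h1]

/-- The limit of the discounted Dynkin formula as the time horizon tends to infinity. -/
theorem integral_discountedGenerator_occupationMeasure (hY : IsDiffusion b σ P ℱ x Y)
    (hb : ContinuousOn b (Ioi 0)) (hσ : ContinuousOn σ (Ioi 0))
    (hr : ContinuousOn r (Ioi 0)) (hr0 : 0 < r₀) (hr₀ : ∀ y, 0 < y → r₀ ≤ r y)
    {K : ℝ} (hK : ∀ y, 0 < y → r y ≤ K) {f : ℝ → ℝ} (hf : ContDiff ℝ 2 f)
    (hfc : HasCompactSupport f) (hfs : tsupport f ⊆ Ioi 0) :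
    Integrable (discountedGenerator b σ r f) (occupationMeasure r P Y) ∧
      ∫ y, discountedGenerator b σ r f y ∂occupationMeasure r P Y = -f x := by
  have hA := continuousOn_generator hb hσ hf
  have hL : ContinuousOn (discountedGenerator b σ r f) (Ioi 0) :=
    hA.sub (hr.mul hf.continuous.continuousOn)
  obtain ⟨B, hB⟩ := exists_bound_of_support_subset hA hfc hfs (support_generator_subset b σ f)
  obtain ⟨B', hB'⟩ := exists_bound_of_support_subset hL hfc hfs (by
    intro y hy
    by_contra hn
    have h1 : generator b σ f y = 0 := by
      by_contra h
      exact hn (support_generator_subset b σ f h)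
    exact hy (by simp [discountedGenerator, h1, image_eq_zero_of_notMem_tsupport hn]))
  obtain ⟨Bf, hBf⟩ := hfc.exists_bound_of_continuous hf.continuous
  have hi := hY.integrable_occupationMeasure_of_bound hr hr0 hr₀ hL fun y _ => hB' y
  refine ⟨hi, ?_⟩
  rw [hY.integral_occupationMeasure hr hL hi]
  set u : ℝ → Ω → ℝ := fun s ω => Real.exp (-discount r Y s ω) *
    discountedGenerator b σ r f (Y s.toNNReal ω) with hu
  have huc : ∀ ω, Continuous fun s => u s ω := fun ω =>
    (hY.continuous_discount hr ω).neg.rexp.mul (hY.continuous_comp hL ω)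
  have hexp : IntegrableOn (fun s => Real.exp (-r₀ * s) * B') (Ioi 0) :=
    (integrableOn_exp_mul_Ioi (by linarith : -r₀ < 0) 0).mul_const B'
  have hub : ∀ ω, ∀ s, 0 ≤ s → ‖u s ω‖ ≤ Real.exp (-r₀ * s) * B' := by
    intro ω s hs
    rw [hu, norm_mul, Real.norm_of_nonneg (Real.exp_pos _).le]
    exact mul_le_mul (hY.exp_neg_discount_le hr hr₀ hs _) (hB' _) (norm_nonneg _)
      (Real.exp_pos _).le
  have hui : ∀ ω, IntegrableOn (fun s => u s ω) (Ioi 0) := by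
    intro ω
    refine hexp.mono' (huc ω).aestronglyMeasurable ?_
    filter_upwards [ae_restrict_mem measurableSet_Ioi] with s hs
    exact hub ω s (le_of_lt hs)
  have hdyn : ∀ n : ℕ, ∫ ω, (Real.exp (-discount r Y n ω) * f (Y (n : ℝ).toNNReal ω)
      - ∫ s in (0 : ℝ)..n, u s ω) ∂P = f x := fun n =>
    hY.integral_exp_mul_sub hr (fun y hy => hr0.le.trans (hr₀ y hy)) hK hf hfc hfs hA
      (fun y _ => hB y) (Nat.cast_nonneg n)
  -- Discounting at rate at least `r₀` kills the terminal term and dominates the running integral by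
  -- an integrable exponential, uniformly in `ω`.
  have hlim : Tendsto (fun n : ℕ => ∫ ω, (Real.exp (-discount r Y n ω) * f (Y (n : ℝ).toNNReal ω)
      - ∫ s in (0 : ℝ)..n, u s ω) ∂P) atTop (𝓝 (∫ ω, -(∫ s in Ioi (0 : ℝ), u s ω) ∂P)) := by
    refine tendsto_integral_of_dominated_convergence
      (fun _ => Bf + ∫ s in Ioi (0 : ℝ), Real.exp (-r₀ * s) * B') ?_ (integrable_const _) ?_ ?_
    · intro n
      refine StronglyMeasurable.aestronglyMeasurable (StronglyMeasurable.sub ?_ ?_)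
      · exact (Real.continuous_exp.comp_stronglyMeasurable
          (hY.stronglyMeasurable_discount hr n).neg).mul
          (hY.stronglyMeasurable_comp hf.continuous.continuousOn _)
      · refine stronglyMeasurable_intervalIntegral huc (fun s => ?_) 0 n
        exact (Real.continuous_exp.comp_stronglyMeasurable
          (hY.stronglyMeasurable_discount hr s).neg).mul (hY.stronglyMeasurable_comp hL _)
    · intro n
      refine Eventually.of_forall fun ω => (norm_sub_le _ _).trans (add_le_add ?_ ?_)
      · have h1 := hY.exp_neg_discount_le hr hr₀ (Nat.cast_nonneg n) ω
        have h2 : Real.exp (-r₀ * n) ≤ 1 := Real.exp_le_one_iff.2 (by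
          have := mul_nonneg hr0.le (Nat.cast_nonneg (α := ℝ) n)
          linarith)
        rw [norm_mul, Real.norm_of_nonneg (Real.exp_pos _).le]
        refine (mul_le_of_le_one_left (norm_nonneg _) (h1.trans h2)).trans (hBf _)
      · rw [intervalIntegral.integral_of_le (Nat.cast_nonneg n)]
        refine (norm_integral_le_of_norm_le (hexp.mono_set Ioc_subset_Ioi_self) ?_).trans
          (setIntegral_mono_set hexp ?_ Ioc_subset_Ioi_self.eventuallyLE)
        · filter_upwards [ae_restrict_mem measurableSet_Ioc] with s hs
          exact hub ω s hs.1.le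
        · exact Eventually.of_forall fun s =>
            mul_nonneg (Real.exp_pos _).le ((abs_nonneg _).trans (hB' 1))
    · refine Eventually.of_forall fun ω => ?_
      rw [← zero_sub]
      refine Tendsto.sub ?_ ?_
      · have h1 := ((hY.tendsto_exp_neg_discount hr hr0 hr₀ ω).comp
          tendsto_natCast_atTop_atTop).mul_const Bf
        rw [zero_mul] at h1
        refine squeeze_zero_norm (fun n => ?_) h1
        rw [norm_mul, Real.norm_of_nonneg (Real.exp_pos _).le]
        exact mul_le_mul_of_nonneg_left (hBf _) (Real.exp_pos _).le
      · exact intervalIntegral_tendsto_integral_Ioi 0 (hui ω) tendsto_natCast_atTop_atTop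
  simp only [hdyn] at hlim
  rw [tendsto_nhds_unique tendsto_const_nhds hlim, integral_neg, neg_neg]

end IsDiffusion

/-! ### Identification of the occupation measure -/

/-- A smooth convex approximation of the positive part, vanishing on `]-∞, 0]`. -/
noncomputable def softPos (δ v : ℝ) : ℝ := ∫ t in (0 : ℝ)..v, Real.smoothTransition (t / δ)

theorem continuous_smoothTransition_div (δ : ℝ) :
    Continuous fun t => Real.smoothTransition (t / δ) :=
  Real.smoothTransition.continuous.comp (continuous_id.div_const δ)

theorem hasDerivAt_softPos (δ v : ℝ) :
    HasDerivAt (softPos δ) (Real.smoothTransition (v / δ)) v :=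
  ((continuous_smoothTransition_div δ).integral_hasStrictDerivAt 0 v).hasDerivAt

theorem contDiff_smoothTransition_div (δ : ℝ) :
    ContDiff ℝ 1 fun t => Real.smoothTransition (t / δ) :=
  (Real.smoothTransition.contDiff (n := 1)).comp (contDiff_id.div_const δ)

theorem contDiff_softPos (δ : ℝ) : ContDiff ℝ 2 (softPos δ) := by
  rw [show (2 : WithTop ℕ∞) = 1 + 1 by norm_num, contDiff_succ_iff_deriv]
  refine ⟨fun v => (hasDerivAt_softPos δ v).differentiableAt, by simp, ?_⟩
  rw [show deriv (softPos δ) = _ from funext fun v => (hasDerivAt_softPos δ v).deriv]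
  exact contDiff_smoothTransition_div δ

theorem monotone_smoothTransition_div {δ : ℝ} (hδ : 0 < δ) :
    Monotone fun t => Real.smoothTransition (t / δ) :=
  fun _ _ hst => Real.smoothTransition.monotone (div_le_div_of_nonneg_right hst hδ.le)

theorem softPos_of_nonpos {δ v : ℝ} (hδ : 0 < δ) (hv : v ≤ 0) : softPos δ v = 0 := by
  rw [softPos, intervalIntegral.integral_congr (g := fun _ => 0), intervalIntegral.integral_zero]
  intro t ht
  rw [uIcc_of_ge hv] at ht
  exact Real.smoothTransition.zero_of_nonpos (div_nonpos_of_nonpos_of_nonneg ht.2 hδ.le)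

/-- The tangent inequality of a convex function vanishing at `0`. It gives the zeroth-order term
`-r·softPos` the right sign when `𝓛` is applied to a composition. -/
theorem softPos_le {δ : ℝ} (hδ : 0 < δ) (v : ℝ) :
    softPos δ v ≤ v * Real.smoothTransition (v / δ) := by
  rcases le_total v 0 with hv | hv
  · rw [softPos_of_nonpos hδ hv, Real.smoothTransition.zero_of_nonpos
      (div_nonpos_of_nonpos_of_nonneg hv hδ.le), mul_zero]
  · have := intervalIntegral.integral_mono_on (μ := volume) hv
      ((continuous_smoothTransition_div δ).intervalIntegrable 0 v)
      (intervalIntegrable_const (c := Real.smoothTransition (v / δ)))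
      fun t ht => monotone_smoothTransition_div hδ ht.2
    simpa [softPos] using this

theorem sub_le_softPos {δ : ℝ} (hδ : 0 < δ) (v : ℝ) : v - δ ≤ softPos δ v := by
  have hnn : ∀ u, 0 ≤ u → 0 ≤ softPos δ u := fun u hu =>
    intervalIntegral.integral_nonneg hu fun t _ => Real.smoothTransition.nonneg _
  rcases le_total v δ with hv | hv
  · rcases le_total v 0 with h0 | h0
    · rw [softPos_of_nonpos hδ h0]; linarith
    · linarith [hnn v h0]
  · have h1 : ∫ t in δ..v, Real.smoothTransition (t / δ) = v - δ := by
      rw [intervalIntegral.integral_congr (g := fun _ => 1)]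
      · simp
      · intro t ht
        rw [uIcc_of_le hv] at ht
        exact Real.smoothTransition.one_of_one_le ((one_le_div hδ).2 ht.1)
    have h2 : softPos δ v = softPos δ δ + ∫ t in δ..v, Real.smoothTransition (t / δ) :=
      (intervalIntegral.integral_add_adjacent_intervals
        ((continuous_smoothTransition_div δ).intervalIntegrable _ _)
        ((continuous_smoothTransition_div δ).intervalIntegrable _ _)).symm
    linarith [hnn δ hδ.le]

/-- The image of a `C²` function under `softPos`. -/
theorem discountedGenerator_indicator_softPos_ge {b σ r v : ℝ → ℝ} (hv : ContDiffOn ℝ 2 v (Ioi 0))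
    {δ : ℝ} (hδ : 0 < δ) {y : ℝ} (hy : 0 < y) (hr : 0 ≤ r y) {F : ℝ} (hF : 0 ≤ F)
    (hL : -F ≤ discountedGenerator b σ r v y) :
    -F ≤ discountedGenerator b σ r ((Ioi 0).indicator (softPos δ ∘ v)) y := by
  have hv1 : ∀ z, 0 < z → HasDerivAt v (deriv v z) z := fun z hz =>
    ((hv.differentiableOn (by norm_num)).differentiableAt (Ioi_mem_nhds hz)).hasDerivAt
  have hv2 : HasDerivAt (deriv v) (deriv (deriv v) y) y :=
    (((hv.deriv_of_isOpen (m := 1) isOpen_Ioi (by norm_num)).differentiableOn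
      (by norm_num)).differentiableAt (Ioi_mem_nhds hy)).hasDerivAt
  set f := (Ioi (0 : ℝ)).indicator (softPos δ ∘ v) with hf
  have hf1 : ∀ z, 0 < z → deriv f z = Real.smoothTransition (v z / δ) * deriv v z := by
    intro z hz
    refine HasDerivAt.deriv (((hasDerivAt_softPos δ (v z)).comp z
      (hv1 z hz)).congr_of_eventuallyEq ?_)
    filter_upwards [Ioi_mem_nhds hz] with w hw
    exact indicator_of_mem hw _
  set k : ℝ → ℝ := fun t => Real.smoothTransition (t / δ) with hk
  have hkd : HasDerivAt k (deriv k (v y)) (v y) :=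
    ((contDiff_smoothTransition_div δ).differentiable (by norm_num) _).hasDerivAt
  have hf2 : deriv (deriv f) y
      = deriv k (v y) * deriv v y * deriv v y + k (v y) * deriv (deriv v) y := by
    refine HasDerivAt.deriv (((hkd.comp y (hv1 y hy)).mul hv2).congr_of_eventuallyEq ?_)
    filter_upwards [Ioi_mem_nhds hy] with w hw
    exact hf1 w hw
  have hk0 : 0 ≤ deriv k (v y) := (monotone_smoothTransition_div hδ).deriv_nonneg
  have hk1 : 0 ≤ k (v y) := Real.smoothTransition.nonneg _
  have hk2 : k (v y) ≤ 1 := Real.smoothTransition.le_one _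
  have hfy : f y = softPos δ (v y) := indicator_of_mem (mem_Ioi.2 hy) _
  have h3 : softPos δ (v y) ≤ v y * k (v y) := softPos_le hδ (v y)
  -- Besides `k(v) 𝓛v` there is a second-order term, nonnegative by convexity, and the tangent
  -- defect, also nonnegative. As `0 ≤ k ≤ 1` and `F ≥ 0`, the main term is at least `-kF ≥ -F`.
  have e : discountedGenerator b σ r f y = k (v y) * discountedGenerator b σ r v y
      + 1 / 2 * deriv k (v y) * (σ y * deriv v y) ^ 2
      + r y * (v y * k (v y) - softPos δ (v y)) := by
    simp only [discountedGenerator, generator, hf2, hf1 y hy, hfy]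
    simp only [hk]
    ring
  rw [e]
  have h4 : 0 ≤ r y * (v y * k (v y) - softPos δ (v y)) := mul_nonneg hr (by linarith)
  have h5 : 0 ≤ 1 / 2 * deriv k (v y) * (σ y * deriv v y) ^ 2 := by positivity
  nlinarith [mul_le_mul_of_nonneg_left hL hk1]

/-- Since `v ≤ 0` near `0`, the composition vanishes there, and extension by zero stays smooth
across the boundary point. -/
theorem contDiff_indicator_softPos {v : ℝ → ℝ} (hv : ContDiffOn ℝ 2 v (Ioi 0))
    {δ : ℝ} (hδ : 0 < δ) {a : ℝ} (ha : 0 < a) (hva : ∀ y, 0 < y → y < a → v y ≤ 0) :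
    ContDiff ℝ 2 ((Ioi 0).indicator (softPos δ ∘ v)) := by
  refine contDiff_iff_contDiffAt.2 fun y => ?_
  rcases lt_or_ge 0 y with hy | hy
  · refine ((contDiff_softPos δ).contDiffAt.comp y
      (hv.contDiffAt (Ioi_mem_nhds hy))).congr_of_eventuallyEq ?_
    filter_upwards [Ioi_mem_nhds hy] with w hw
    exact indicator_of_mem hw _
  · refine (contDiffAt_const (c := (0 : ℝ))).congr_of_eventuallyEq ?_
    filter_upwards [Iio_mem_nhds (hy.trans_lt ha)] with w hw
    by_cases h : w ∈ Ioi (0 : ℝ)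
    · rw [indicator_of_mem h]
      exact softPos_of_nonpos hδ (hva w h hw)
    · exact indicator_of_notMem h _

theorem support_indicator_softPos_subset {v : ℝ → ℝ} {δ : ℝ} (hδ : 0 < δ) {a c : ℝ}
    (hva : ∀ y, 0 < y → y ∉ Icc a c → v y ≤ 0) :
    Function.support ((Ioi 0).indicator (softPos δ ∘ v)) ⊆ Icc a c := by
  intro y hy
  by_contra hn
  by_cases h : y ∈ Ioi (0 : ℝ)
  · rw [Function.mem_support, indicator_of_mem h] at hy
    exact hy (softPos_of_nonpos hδ (hva y h hn))
  · rw [Function.mem_support, indicator_of_notMem h] at hy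
    exact hy rfl

section Occupation

variable {Ω : Type*} [mΩ : MeasurableSpace Ω] {P : Measure Ω} [IsProbabilityMeasure P]
  {ℱ : Filtration ℝ≥0 mΩ} {b σ r φ ψ F : ℝ → ℝ} {x : ℝ} {Y : ℝ≥0 → Ω → ℝ}

/-- A comparison principle for the occupation measure. -/
theorem IsDiffusion.le_integral_occupationMeasure (hY : IsDiffusion b σ P ℱ x Y) (hx : 0 < x)
    (hb : ContinuousOn b (Ioi 0)) (hσ : ContinuousOn σ (Ioi 0)) (hr : ContinuousOn r (Ioi 0))
    {r₀ : ℝ} (hr0 : 0 < r₀) (hr₀ : ∀ y, 0 < y → r₀ ≤ r y) {K : ℝ} (hK : ∀ y, 0 < y → r y ≤ K)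
    {v : ℝ → ℝ} (hv : ContDiffOn ℝ 2 v (Ioi 0)) (hF0 : ∀ y, 0 < y → 0 ≤ F y)
    (hF : Integrable F (occupationMeasure r P Y))
    (hL : ∀ y, 0 < y → -F y ≤ discountedGenerator b σ r v y)
    {a c : ℝ} (ha : 0 < a) (hva : ∀ y, 0 < y → y ∉ Icc a c → v y ≤ 0) :
    v x ≤ ∫ y, F y ∂occupationMeasure r P Y := by
  refine le_of_forall_pos_le_add fun δ hδ => ?_
  have hsupp := support_indicator_softPos_subset hδ hva
  have hfx : (Ioi (0 : ℝ)).indicator (softPos δ ∘ v) x = softPos δ (v x) :=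
    indicator_of_mem (mem_Ioi.2 hx) _
  obtain ⟨hi, he⟩ := hY.integral_discountedGenerator_occupationMeasure hb hσ hr hr0 hr₀ hK
    (contDiff_indicator_softPos hv hδ ha fun y hy hya => hva y hy fun h => absurd h.1 hya.not_ge)
    (HasCompactSupport.of_support_subset_isCompact isCompact_Icc hsupp)
    ((closure_minimal hsupp isClosed_Icc).trans fun y hy => ha.trans_le hy.1)
  -- Integrating `-F ≤ 𝓛f` and using Dynkin's formula gives `softPos δ (v x) ≤ ∫ F`; the left side
  -- is at least `v x - δ`.
  have := integral_mono_ae hF.neg hi (by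
    filter_upwards [hY.ae_mem_Ioi] with y hy
    exact discountedGenerator_indicator_softPos_ge hv hδ hy (hr0.le.trans (hr₀ y hy))
      (hF0 y hy) (hL y hy))
  simp only [Pi.neg_apply] at this
  rw [integral_neg, he, hfx] at this
  linarith [sub_le_softPos hδ (v x)]

/-! ### Comparison of the Green function with the occupation integral -/

namespace FundamentalPair

theorem greenFun_le (h : FundamentalPair b σ r φ ψ) (hF : GreenIntegrable b σ φ ψ F) {M : ℝ}
    (hM : ∀ y, 0 < y → F y ≤ M * r y) (hx : 0 < x) : greenFun b σ φ ψ F x ≤ M := by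
  have h1 := h.greenFun_nonneg (F := fun y => M * r y - F y) (fun y hy => sub_nonneg.2 (hM y hy)) hx
  rw [h.greenFun_const_mul_r_sub hF M hx] at h1
  linarith

theorem discountedGenerator_greenFun_sub (h : FundamentalPair b σ r φ ψ)
    (hF : GreenIntegrable b σ φ ψ F) (ε : ℝ) (hx : 0 < x) :
    discountedGenerator b σ r (fun y => greenFun b σ φ ψ F y - ε * (φ y + ψ y)) x = -F x := by
  have e0 := h.discountedGenerator_greenFun hF hx
  have e1 := h.dec.ode x hx
  have e2 := h.inc.ode x hx
  have d1 : ∀ y, 0 < y → deriv (fun y => greenFun b σ φ ψ F y - ε * (φ y + ψ y)) y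
      = deriv (greenFun b σ φ ψ F) y - ε * (deriv φ y + deriv ψ y) := fun y hy =>
    ((h.hasDerivAt_greenFun hF hy).differentiableAt.hasDerivAt.fun_sub
      (((h.dec.hasDerivAt hy).fun_add (h.inc.hasDerivAt hy)).const_mul ε)).deriv
  have d2 : deriv (deriv fun y => greenFun b σ φ ψ F y - ε * (φ y + ψ y)) x
      = deriv (deriv (greenFun b σ φ ψ F)) x
        - ε * (deriv (deriv φ) x + deriv (deriv ψ) x) := by
    have hg : DifferentiableAt ℝ (deriv (greenFun b σ φ ψ F)) x :=
      (((h.contDiffOn_greenFun hF).deriv_of_isOpen (m := 1) isOpen_Ioi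
        (by norm_num)).differentiableOn (by norm_num)).differentiableAt (Ioi_mem_nhds hx)
    refine HasDerivAt.deriv ((hg.hasDerivAt.fun_sub (((h.dec.hasDerivAt_deriv hx).fun_add
      (h.inc.hasDerivAt_deriv hx)).const_mul ε)).congr_of_eventuallyEq ?_)
    filter_upwards [Ioi_mem_nhds hx] with y hy
    exact d1 y hy
  simp only [discountedGenerator, generator, d2, d1 x hx] at e0 e1 e2 ⊢
  linear_combination e0 - ε * e1 - ε * e2

/-- Each of `φ` and `ψ` explodes at one boundary point. The barrier `ε(φ + ψ)` therefore localises
to a compact set without changing `𝓛u`. -/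
theorem exists_Icc_le_mul_add (h : FundamentalPair b σ r φ ψ) {ε : ℝ} (hε : 0 < ε) (M : ℝ) :
    ∃ a c, 0 < a ∧ ∀ y, 0 < y → y ∉ Icc a c → M ≤ ε * (φ y + ψ y) := by
  obtain ⟨a, ha0, ha⟩ := mem_nhdsGT_iff_exists_Ioo_subset.1
    (h.tendsto_dec_zero.eventually_ge_atTop (M / ε))
  obtain ⟨c, hc⟩ := eventually_atTop.1 (h.tendsto_inc_atTop.eventually_ge_atTop (M / ε))
  refine ⟨a, c, ha0, fun y hy hn => ?_⟩
  rw [← div_le_iff₀' hε]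
  have h1 := h.dec.pos y hy
  have h2 := h.inc.pos y hy
  rcases lt_or_ge y a with hya | hya
  · have : M / ε ≤ φ y := ha ⟨hy, hya⟩
    linarith
  · have : M / ε ≤ ψ y := hc y (not_le.1 fun hyc => hn ⟨hya, hyc⟩).le
    linarith

theorem greenFun_le_integral (h : FundamentalPair b σ r φ ψ) {K : ℝ}
    (hK : ∀ y, 0 < y → r y ≤ K) (hY : IsDiffusion b σ P ℱ x Y) (hx : 0 < x)
    (hFc : ContinuousOn F (Ioi 0)) (hF0 : ∀ y, 0 < y → 0 ≤ F y) {M : ℝ}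
    (hM : ∀ y, 0 < y → F y ≤ M * r y) (hFi : Integrable F (occupationMeasure r P Y)) :
    greenFun b σ φ ψ F x ≤ ∫ y, F y ∂occupationMeasure r P Y := by
  obtain ⟨r₀, hr0, hr₀⟩ := h.exists_le_r
  have hF := h.greenIntegrable_of_le hFc hF0 hM
  refine le_of_forall_pos_le_add fun η hη => ?_
  have hS : 0 < φ x + ψ x := add_pos (h.dec.pos x hx) (h.inc.pos x hx)
  -- With this weight the barrier costs exactly `η` at the starting point.
  have hε : 0 < η / (φ x + ψ x) := div_pos hη hS
  obtain ⟨a, c, ha, hac⟩ := h.exists_Icc_le_mul_add hε M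
  have := hY.le_integral_occupationMeasure hx h.continuousOn_b h.continuousOn_σ h.continuousOn_r
    hr0 hr₀ hK ((h.contDiffOn_greenFun hF).sub (contDiffOn_const.mul
      (h.dec.contDiffOn.add h.inc.contDiffOn))) hF0 hFi
    (fun y hy => (h.discountedGenerator_greenFun_sub hF (η / (φ x + ψ x)) hy).ge) ha
    (fun y hy hn => sub_nonpos.2 ((h.greenFun_le hF hM hy).trans (hac y hy hn)))
  rw [div_mul_cancel₀ _ hS.ne'] at this
  linarith

/-- The one-sided comparison applies to `F` and to `M r - F`. Their sum `M r` has the value `M` on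
both sides, so neither inequality can be strict. -/
theorem integral_eq_greenFun (h : FundamentalPair b σ r φ ψ) {K : ℝ}
    (hK : ∀ y, 0 < y → r y ≤ K) (hY : IsDiffusion b σ P ℱ x Y) (hx : 0 < x)
    (hFc : ContinuousOn F (Ioi 0)) (hF0 : ∀ y, 0 < y → 0 ≤ F y) {M : ℝ}
    (hM : ∀ y, 0 < y → F y ≤ M * r y) :
    Integrable F (occupationMeasure r P Y) ∧
      ∫ y, F y ∂occupationMeasure r P Y = greenFun b σ φ ψ F x := by
  obtain ⟨r₀, hr0, hr₀⟩ := h.exists_le_r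
  have hM0 : 0 ≤ M := by
    by_contra! hn
    nlinarith [hF0 1 one_pos, hM 1 one_pos, h.r_pos one_pos]
  have hri := hY.integrable_occupationMeasure_of_bound h.continuousOn_r hr0 hr₀ h.continuousOn_r
    (K := K) fun y hy => by rw [abs_of_pos (h.r_pos hy)]; exact hK y hy
  have hFi := hY.integrable_occupationMeasure_of_bound h.continuousOn_r hr0 hr₀ hFc
    (K := M * K) fun y hy => by
      rw [abs_of_nonneg (hF0 y hy)]
      exact (hM y hy).trans (mul_le_mul_of_nonneg_left (hK y hy) hM0)
  refine ⟨hFi, le_antisymm ?_ (h.greenFun_le_integral hK hY hx hFc hF0 hM hFi)⟩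
  have h1 := h.greenFun_le_integral hK hY hx (F := fun y => M * r y - F y)
    ((continuousOn_const.mul h.continuousOn_r).sub hFc) (fun y hy => sub_nonneg.2 (hM y hy))
    (M := M) (fun y hy => by linarith [hF0 y hy]) ((hri.const_mul M).sub hFi)
  rw [h.greenFun_const_mul_r_sub (h.greenIntegrable_of_le hFc hF0 hM) M hx,
    integral_sub (hri.const_mul M) hFi, integral_const_mul,
    hY.integral_rate_occupationMeasure h.continuousOn_r hr0 hr₀ hK] at h1
  linarith

end FundamentalPair

end Occupation

/-! ### The Green kernel as a measure -/

section Density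

variable {ν : Measure ℝ} {k g : ℝ → ℝ}

theorem integrable_withDensity_toNNReal_iff (hk : AEMeasurable k ν) (hk0 : ∀ᵐ s ∂ν, 0 ≤ k s) :
    Integrable g (ν.withDensity fun s => (k s).toNNReal) ↔ Integrable (fun s => k s * g s) ν := by
  rw [integrable_withDensity_iff_integrable_smul₀ hk.real_toNNReal]
  refine integrable_congr ?_
  filter_upwards [hk0] with s hs
  simp [NNReal.smul_def, hs]

theorem integral_withDensity_toNNReal (hk : AEMeasurable k ν) (hk0 : ∀ᵐ s ∂ν, 0 ≤ k s) :
    ∫ s, g s ∂(ν.withDensity fun s => (k s).toNNReal) = ∫ s, k s * g s ∂ν := by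
  rw [integral_withDensity_eq_integral_smul₀ hk.real_toNNReal]
  refine integral_congr_ae ?_
  filter_upwards [hk0] with s hs
  simp [NNReal.smul_def, hs]

end Density

/-- The measure with density the Green kernel `φ(x) Ψ(s) 1_{s ≤ x} + ψ(x) Φ(s) 1_{s > x}`. -/
noncomputable def greenMeasure (b σ φ ψ : ℝ → ℝ) (x : ℝ) : Measure ℝ :=
  (volume.restrict (Ioc 0 x)).withDensity (fun s => (φ x * bigPsi b σ φ ψ s).toNNReal) +
    (volume.restrict (Ioi x)).withDensity (fun s => (ψ x * bigPhi b σ φ ψ s).toNNReal)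

namespace FundamentalPair

variable {b σ r φ ψ F : ℝ → ℝ} {x : ℝ}

theorem integrable_greenMeasure_iff (h : FundamentalPair b σ r φ ψ) (hx : 0 < x) :
    Integrable F (greenMeasure b σ φ ψ x) ↔
      IntegrableOn (fun s => F s * bigPsi b σ φ ψ s) (Ioc 0 x) ∧
        IntegrableOn (fun s => F s * bigPhi b σ φ ψ s) (Ioi x) := by
  rw [greenMeasure, integrable_add_measure, integrable_withDensity_toNNReal_iff,
    integrable_withDensity_toNNReal_iff]
  · simp only [mul_assoc, integrable_const_mul_iff (h.dec.pos x hx).ne'.isUnit,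
      integrable_const_mul_iff (h.inc.pos x hx).ne'.isUnit, IntegrableOn]
    simp only [mul_comm]
  · exact (((continuousOn_const.mul h.continuousOn_bigPhi).mono
      (Ioi_subset_Ioi hx.le)).aestronglyMeasurable measurableSet_Ioi).aemeasurable
  · filter_upwards [ae_restrict_mem measurableSet_Ioi] with s hs
    exact (mul_pos (h.inc.pos x hx) (h.bigPhi_pos (hx.trans hs))).le
  · exact (((continuousOn_const.mul h.continuousOn_bigPsi).mono
      Ioc_subset_Ioi_self).aestronglyMeasurable measurableSet_Ioc).aemeasurable
  · filter_upwards [ae_restrict_mem measurableSet_Ioc] with s hs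
    exact (mul_pos (h.dec.pos x hx) (h.bigPsi_pos hs.1)).le

theorem integral_greenMeasure (h : FundamentalPair b σ r φ ψ) (hx : 0 < x)
    (hF : Integrable F (greenMeasure b σ φ ψ x)) :
    ∫ s, F s ∂greenMeasure b σ φ ψ x = greenFun b σ φ ψ F x := by
  have h1 := integrable_add_measure.1 hF
  rw [greenMeasure, integral_add_measure h1.1 h1.2, integral_withDensity_toNNReal,
    integral_withDensity_toNNReal]
  · simp only [mul_assoc, integral_const_mul, greenFun]
    simp only [mul_comm]
  · exact (((continuousOn_const.mul h.continuousOn_bigPhi).mono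
      (Ioi_subset_Ioi hx.le)).aestronglyMeasurable measurableSet_Ioi).aemeasurable
  · filter_upwards [ae_restrict_mem measurableSet_Ioi] with s hs
    exact (mul_pos (h.inc.pos x hx) (h.bigPhi_pos (hx.trans hs))).le
  · exact (((continuousOn_const.mul h.continuousOn_bigPsi).mono
      Ioc_subset_Ioi_self).aestronglyMeasurable measurableSet_Ioc).aemeasurable
  · filter_upwards [ae_restrict_mem measurableSet_Ioc] with s hs
    exact (mul_pos (h.dec.pos x hx) (h.bigPsi_pos hs.1)).le

variable {Ω : Type*} [mΩ : MeasurableSpace Ω] {P : Measure Ω} [IsProbabilityMeasure P]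
  {ℱ : Filtration ℝ≥0 mΩ} {Y : ℝ≥0 → Ω → ℝ}

/-- Bounded continuous nonnegative functions determine a finite measure, and each is at most a
multiple of `r` because `r ≥ r₀`. Equality as measures then carries both integrability and integrals
over to unbounded `F`. -/
theorem occupationMeasure_eq (h : FundamentalPair b σ r φ ψ) {K : ℝ}
    (hK : ∀ y, 0 < y → r y ≤ K) (hY : IsDiffusion b σ P ℱ x Y) (hx : 0 < x) :
    occupationMeasure r P Y = greenMeasure b σ φ ψ x := by
  obtain ⟨r₀, hr0, hr₀⟩ := h.exists_le_r
  have h1 := hY.isFiniteMeasure_occupationMeasure h.continuousOn_r hr0 hr₀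
  have key : ∀ f : ℝ → ℝ, Continuous f → (∀ y, 0 ≤ f y) → (∃ B, ∀ y, f y ≤ B) →
      Integrable f (occupationMeasure r P Y) ∧ Integrable f (greenMeasure b σ φ ψ x) ∧
      ∫ y, f y ∂occupationMeasure r P Y = ∫ y, f y ∂greenMeasure b σ φ ψ x := by
    rintro f hf hf0 ⟨B, hB⟩
    have hM : ∀ y, 0 < y → f y ≤ B / r₀ * r y := by
      intro y hy
      have hB0 : 0 ≤ B := (hf0 0).trans (hB 0)
      calc f y ≤ B := hB y
        _ = B / r₀ * r₀ := by field_simp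
        _ ≤ B / r₀ * r y := by gcongr; exact hr₀ y hy
    obtain ⟨i1, e1⟩ := h.integral_eq_greenFun hK hY hx hf.continuousOn (fun y _ => hf0 y) hM
    have hg := h.greenIntegrable_of_le hf.continuousOn (fun y _ => hf0 y) hM
    have i2 := (h.integrable_greenMeasure_iff hx).2 ⟨hg.left x hx, hg.right x hx⟩
    exact ⟨i1, i2, e1.trans (h.integral_greenMeasure hx i2).symm⟩
  refine ext_of_forall_lintegral_eq_of_IsFiniteMeasure fun f => ?_
  obtain ⟨i1, i2, e⟩ := key (fun y => (f y : ℝ)) (NNReal.continuous_coe.comp f.continuous)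
    (fun y => (f y).2) ⟨nndist f 0, fun y => by
      exact_mod_cast BoundedContinuousFunction.NNReal.upper_bound f y⟩
  have e1 := ofReal_integral_eq_lintegral_ofReal i1 (Eventually.of_forall fun y => (f y).2)
  have e2 := ofReal_integral_eq_lintegral_ofReal i2 (Eventually.of_forall fun y => (f y).2)
  simp only [ENNReal.ofReal_coe_nnreal] at e1 e2
  rw [← e1, ← e2, e]

theorem greenIntegrable_of_finiteDiscountedIntegral (h : FundamentalPair b σ r φ ψ) {K : ℝ}
    (hK : ∀ y, 0 < y → r y ≤ K) {X : ℝ → ℝ≥0 → Ω → ℝ}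
    (hX : ∀ x, 0 < x → IsDiffusion b σ P ℱ x (X x)) (hF : ContinuousOn F (Ioi 0))
    (hFi : ∀ x, 0 < x → FiniteDiscountedIntegral r P (X x) F) :
    GreenIntegrable b σ φ ψ F := by
  have := fun x (hx : 0 < x) => (hX x hx).integrable_of_finiteDiscountedIntegral
    h.continuousOn_r hF (hFi x hx)
  exact ⟨hF, fun x hx => ((h.integrable_greenMeasure_iff hx).1
      (h.occupationMeasure_eq hK (hX x hx) hx ▸ this x hx)).1,
    fun x hx => ((h.integrable_greenMeasure_iff hx).1
      (h.occupationMeasure_eq hK (hX x hx) hx ▸ this x hx)).2⟩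

/-- The resolvent is given by the Green operator. -/
theorem resolvent_eq_greenFun (h : FundamentalPair b σ r φ ψ) {K : ℝ}
    (hK : ∀ y, 0 < y → r y ≤ K) {X : ℝ → ℝ≥0 → Ω → ℝ}
    (hX : ∀ x, 0 < x → IsDiffusion b σ P ℱ x (X x)) (hF : ContinuousOn F (Ioi 0))
    (hFi : ∀ x, 0 < x → FiniteDiscountedIntegral r P (X x) F) (hx : 0 < x) :
    resolvent r P X F x = greenFun b σ φ ψ F x := by
  have hi := (hX x hx).integrable_of_finiteDiscountedIntegral h.continuousOn_r hF (hFi x hx)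
  rw [resolvent, ← (hX x hx).integral_occupationMeasure h.continuousOn_r hF hi]
  rw [h.occupationMeasure_eq hK (hX x hx) hx] at hi ⊢
  exact h.integral_greenMeasure hx hi

end FundamentalPair

/-! ### Monotone functions and their limits -/

theorem strictMonoOn_Ioc_of_continuousAt {f : ℝ → ℝ} {a c : ℝ} (h : StrictMonoOn f (Ioo a c))
    (hc : ContinuousAt f c) : StrictMonoOn f (Ioc a c) := by
  intro x hx y hy hxy
  rcases hy.2.eq_or_lt with rfl | hyc
  · obtain ⟨z, hxz, hzy⟩ := exists_between hxy
    have hz : z ∈ Ioo a y := ⟨hx.1.trans hxz, hzy⟩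
    refine (h ⟨hx.1, hxy⟩ hz hxz).trans_le ?_
    refine ge_of_tendsto (hc.tendsto.mono_left (nhdsWithin_le_nhds (s := Iio y))) ?_
    filter_upwards [Ioo_mem_nhdsLT hzy] with w hw
    exact h.monotoneOn hz ⟨hz.1.trans hw.1, hw.2⟩ hw.1.le
  · exact h ⟨hx.1, hxy.trans hyc⟩ ⟨hy.1, hyc⟩ hxy

theorem strictAntiOn_Ici_of_continuousAt {f : ℝ → ℝ} {c : ℝ} (h : StrictAntiOn f (Ioi c))
    (hc : ContinuousAt f c) : StrictAntiOn f (Ici c) := by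
  intro x hx y hy hxy
  rcases (mem_Ici.1 hx).eq_or_lt with rfl | hcx
  · obtain ⟨z, hxz, hzy⟩ := exists_between hxy
    refine (h hxz hxy hzy).trans_le ?_
    refine ge_of_tendsto (hc.tendsto.mono_left (nhdsWithin_le_nhds (s := Ioi c))) ?_
    filter_upwards [Ioo_mem_nhdsGT hxz] with w hw
    exact h.antitoneOn hw.1 hxz hw.2.le
  · exact h hcx (hcx.trans hxy) hxy

theorem exists_tendsto_atTop_of_monotoneOn {f : ℝ → ℝ} {a : ℝ} (hf : MonotoneOn f (Ici a)) :
    ∃ q : EReal, Tendsto (fun x => (f x : EReal)) atTop (𝓝 q) := by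
  -- Freezing `f` to the left of `a` makes it monotone on the whole line, and suprema always exist
  -- in `EReal`.
  have hm : Monotone fun x => (f (max a x) : EReal) := fun x y hxy =>
    EReal.coe_le_coe_iff.2 (hf (mem_Ici.2 (le_max_left a x)) (mem_Ici.2 (le_max_left a y)) (max_le_max le_rfl hxy))
  refine ⟨_, (tendsto_atTop_iSup hm).congr' ?_⟩
  filter_upwards [eventually_ge_atTop a] with x hx
  rw [max_eq_right hx]

theorem exists_tendsto_atTop_of_antitoneOn {f : ℝ → ℝ} {a : ℝ} (hf : AntitoneOn f (Ici a)) :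
    ∃ q : EReal, Tendsto (fun x => (f x : EReal)) atTop (𝓝 q) := by
  have hm : Antitone fun x => (f (max a x) : EReal) := fun x y hxy =>
    EReal.coe_le_coe_iff.2 (hf (mem_Ici.2 (le_max_left a x)) (mem_Ici.2 (le_max_left a y)) (max_le_max le_rfl hxy))
  refine ⟨_, (tendsto_atTop_iInf hm).congr' ?_⟩
  filter_upwards [eventually_ge_atTop a] with x hx
  rw [max_eq_right hx]

theorem exists_tendsto_zero_of_monotoneOn {f : ℝ → ℝ} {a : ℝ} (ha : 0 < a)
    (hf : MonotoneOn f (Ioo 0 a)) :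
    ∃ q : EReal, Tendsto (fun x => (f x : EReal)) (𝓝[>] 0) (𝓝 q) :=
  ⟨_, MonotoneOn.tendsto_nhdsWithin_Ioo_right (f := fun x => (f x : EReal)) (nonempty_Ioo.2 ha)
    (fun _ hx _ hy hxy => EReal.coe_le_coe_iff.2 (hf hx hy hxy)) (OrderBot.bddBelow _)⟩

theorem exists_tendsto_zero_of_antitoneOn {f : ℝ → ℝ} {a : ℝ} (ha : 0 < a)
    (hf : AntitoneOn f (Ioo 0 a)) :
    ∃ q : EReal, Tendsto (fun x => (f x : EReal)) (𝓝[>] 0) (𝓝 q) :=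
  ⟨_, AntitoneOn.tendsto_nhdsWithin_Ioo_right (f := fun x => (f x : EReal)) (nonempty_Ioo.2 ha)
    (fun _ hx _ hy hxy => EReal.coe_le_coe_iff.2 (hf hx hy hxy)) (OrderTop.bddAbove _)⟩

/-! ### A converse of l'Hôpital's rule for monotone ratios -/

section RatioLimit

variable {u ψ ψ' g : ℝ → ℝ} {a : ℝ}

/-- The function `u - cψ` is nondecreasing, so `u/ψ` is bounded below by `c` up to a term vanishing
with `1/ψ`. -/
theorem le_zero_of_le_ratio (hψ : ∀ x, a ≤ x → HasDerivAt ψ (ψ' x) x)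
    (hψ' : ∀ x, a ≤ x → 0 ≤ ψ' x) (hψlim : Tendsto ψ atTop atTop)
    (hu : ∀ x, a ≤ x → HasDerivAt u (g x * ψ' x) x)
    (hlim : Tendsto (fun x => u x / ψ x) atTop (𝓝 0)) {c : ℝ} (hc : ∀ x, a ≤ x → c ≤ g x) :
    c ≤ 0 := by
  have h1 : Tendsto (fun x => c + (u a - c * ψ a) / ψ x) atTop (𝓝 (c + 0)) :=
    tendsto_const_nhds.add (hψlim.const_div_atTop _)
  rw [add_zero] at h1
  refine le_of_tendsto_of_tendsto h1 hlim ?_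
  filter_upwards [eventually_ge_atTop a, hψlim.eventually_gt_atTop 0] with x hx hx0
  have := sub_le_sub_of_hasDerivAt hx (fun y hy => (hψ y hy.1).const_mul c)
    (fun y hy => hu y hy.1) fun y hy => mul_le_mul_of_nonneg_right (hc y hy.1) (hψ' y hy.1)
  rw [le_div_iff₀ hx0, add_mul, div_mul_cancel₀ _ hx0.ne']
  linarith

theorem tendsto_zero_of_monotoneOn_ratio (hψ : ∀ x, a ≤ x → HasDerivAt ψ (ψ' x) x)
    (hψ' : ∀ x, a ≤ x → 0 ≤ ψ' x) (hψlim : Tendsto ψ atTop atTop)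
    (hu : ∀ x, a ≤ x → HasDerivAt u (g x * ψ' x) x)
    (hlim : Tendsto (fun x => u x / ψ x) atTop (𝓝 0)) (hg : MonotoneOn g (Ici a)) :
    Tendsto g atTop (𝓝 0) := by
  have hle : ∀ x, a ≤ x → g x ≤ 0 := fun x hx =>
    le_zero_of_le_ratio (a := x) (fun y hy => hψ y (hx.trans hy)) (fun y hy => hψ' y (hx.trans hy))
      hψlim (fun y hy => hu y (hx.trans hy)) hlim fun y hy => hg hx (hx.trans hy) hy
  refine tendsto_order.2 ⟨fun c hc => ?_, fun c hc => ?_⟩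
  · obtain ⟨x, hx, hcx⟩ : ∃ x, a ≤ x ∧ c < g x := by
      by_contra! hn
      have := le_zero_of_le_ratio (u := fun x => -u x) (g := fun x => -g x) (c := -c)
        hψ hψ' hψlim (fun x hx => by simpa using (hu x hx).fun_neg)
        (by simpa [neg_div] using hlim.neg) fun x hx => neg_le_neg (hn x hx)
      linarith
    filter_upwards [eventually_ge_atTop x] with y hy
    exact hcx.trans_le (hg hx (hx.trans hy) hy)
  · filter_upwards [eventually_ge_atTop a] with y hy
    exact (hle y hy).trans_lt hc

theorem tendsto_zero_of_antitoneOn_ratio (hψ : ∀ x, a ≤ x → HasDerivAt ψ (ψ' x) x)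
    (hψ' : ∀ x, a ≤ x → 0 ≤ ψ' x) (hψlim : Tendsto ψ atTop atTop)
    (hu : ∀ x, a ≤ x → HasDerivAt u (g x * ψ' x) x)
    (hlim : Tendsto (fun x => u x / ψ x) atTop (𝓝 0)) (hg : AntitoneOn g (Ici a)) :
    Tendsto g atTop (𝓝 0) := by
  have := tendsto_zero_of_monotoneOn_ratio (u := fun x => -u x) (g := fun x => -g x)
    hψ hψ' hψlim (fun x hx => by simpa using (hu x hx).fun_neg)
    (by simpa [neg_div] using hlim.neg) hg.neg
  simpa using this.neg

end RatioLimit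

/-- The limit at `0` and the upper point of a function that decreases and then increases to `0`. -/
theorem exists_limit_and_upperPoint {g : ℝ → ℝ} {x₀ : ℝ} (hx₀ : 0 < x₀)
    (hanti : StrictAntiOn g (Ioc 0 x₀)) (hmono : StrictMonoOn g (Ici x₀))
    (hcont : ContinuousAt g x₀) (hlim : Tendsto g atTop (𝓝 0)) :
    ∃ L : EReal, Tendsto (fun x => (g x : EReal)) (𝓝[>] 0) (𝓝 L) ∧
      (x₀ : EReal) < upperPoint g L ∧ (upperPoint g L = ⊤ ↔ 0 ≤ L) := by
  obtain ⟨L, hL⟩ := exists_tendsto_zero_of_antitoneOn hx₀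
    (hanti.mono Ioo_subset_Ioc_self).antitoneOn
  -- The intermediate point `x / 2` supplies the strictness that the passage to the limit would
  -- lose.
  have hlt : ∀ x, 0 < x → x ≤ x₀ → (g x : EReal) < L := by
    intro x hx hx1
    have h2 : (g x : EReal) < g (x / 2) :=
      EReal.coe_lt_coe_iff.2 (hanti ⟨by linarith, by linarith⟩ ⟨hx, hx1⟩ (by linarith))
    refine h2.trans_le (ge_of_tendsto hL ?_)
    filter_upwards [Ioo_mem_nhdsGT (half_pos hx)] with y hy
    exact EReal.coe_le_coe_iff.2 (hanti.antitoneOn ⟨hy.1, by linarith [hy.2]⟩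
      ⟨by linarith, by linarith⟩ hy.2.le)
  have hneg : ∀ x, x₀ ≤ x → g x < 0 := by
    intro x hx
    have h1 : g x < g (x + 1) := hmono hx (mem_Ici.2 (by linarith)) (by linarith)
    refine h1.trans_le (ge_of_tendsto hlim ?_)
    filter_upwards [eventually_ge_atTop (x + 1)] with y hy
    exact hmono.monotoneOn (mem_Ici.2 (by linarith)) (mem_Ici.2 (by linarith)) hy
  refine ⟨L, hL, ?_, ?_, ?_⟩
  -- By continuity `g < L` persists slightly beyond `x₀`, which keeps the infimum strictly to the
  -- right of `x₀`.
  · have h1 : ∀ᶠ y in 𝓝 x₀, (g y : EReal) < L :=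
      (continuous_coe_real_ereal.continuousAt.comp hcont).eventually_lt_const (hlt x₀ hx₀ le_rfl)
    have h2 : {y : ℝ | (g y : EReal) < L} ∈ 𝓝[≥] x₀ := mem_nhdsWithin_of_mem_nhds h1
    obtain ⟨d, hd, hsub⟩ := mem_nhdsGE_iff_exists_Ico_subset.1 h2
    refine (EReal.coe_lt_coe_iff.2 hd).trans_le (le_sInf ?_)
    rintro _ ⟨s, ⟨hs, hsL⟩, rfl⟩
    refine EReal.coe_le_coe_iff.2 ?_
    by_contra! hsd
    rcases le_total s x₀ with hsx | hsx
    · exact lt_asymm hsL (hlt s hs hsx)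
    · exact lt_asymm hsL (hsub ⟨hsx, hsd⟩)
  · intro htop
    by_contra! hL0
    have h1 : ∀ᶠ y in atTop, L < (g y : EReal) :=
      ((continuous_coe_real_ereal.tendsto 0).comp hlim).eventually_const_lt hL0
    obtain ⟨s, hs, hsL⟩ := ((eventually_gt_atTop 0).and h1).exists
    have : upperPoint g L ≤ (s : EReal) := sInf_le ⟨s, ⟨hs, hsL⟩, rfl⟩
    rw [htop, top_le_iff] at this
    exact EReal.coe_ne_top s this
  · intro hL0
    refine sInf_eq_top.2 ?_
    rintro _ ⟨s, ⟨hs, hsL⟩, rfl⟩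
    exfalso
    rcases le_total s x₀ with hsx | hsx
    · exact lt_asymm hsL (hlt s hs hsx)
    · have : (g s : EReal) < 0 := EReal.coe_lt_coe_iff.2 (hneg s hsx)
      exact lt_asymm hsL (this.trans_le hL0)

/-- At a real point strictly between two candidates the derivative would have both signs; the point
is positive because candidates exceed `ξ`. -/
theorem IsTurningPoint.unique {ξ : ℝ} {g : ℝ → ℝ} {y z : EReal} (hξ : 0 < ξ)
    (hy : IsTurningPoint ξ g y) (hz : IsTurningPoint ξ g z) : y = z := by
  have key : ∀ {y z : EReal}, IsTurningPoint ξ g y → IsTurningPoint ξ g z → ¬ y < z := by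
    intro y z hy hz hyz
    obtain ⟨s, h1, h2⟩ := EReal.lt_iff_exists_real_btwn.1 hyz
    have hs : 0 < s := hξ.trans (EReal.coe_lt_coe_iff.1 (hy.1.trans h1))
    exact lt_asymm (hz.2.1 s hs h2) (hy.2.2 s h1)
  exact le_antisymm (not_lt.1 (key hz hy)) (not_lt.1 (key hy hz))

namespace FundamentalPair

variable {b σ r φ ψ F : ℝ → ℝ} {x : ℝ}

/-! ### The ratio of derivatives of the Green function -/

/-- In `R''ψ' - R'ψ''` the drift terms cancel. What is left is `r(Rψ' - R'ψ) - Fψ'` up to `2/σ²`,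
and `Rψ' - R'ψ = Cp' ∫₀ˣ FΨ` by the Wronskian identity. -/
theorem hasDerivAt_greenDeriv_div (h : FundamentalPair b σ r φ ψ)
    (hF : GreenIntegrable b σ φ ψ F) (hx : 0 < x) :
    HasDerivAt (fun y => greenDeriv b σ φ ψ F y / deriv ψ y)
      (2 * r x * wronskianConst φ ψ * scaleDeriv b σ x / (σ x ^ 2 * deriv ψ x ^ 2) *
        Qfun b σ r φ ψ F x) x := by
  have h1 := h.wronskian_eq hx
  have h2 := h.wronskianConst_pos.ne'
  have h3 := (scaleDeriv_pos b σ x).ne'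
  have h4 := (h.σ_pos x hx).ne'
  have h5 := (h.inc.deriv_pos x hx).ne'
  have h6 := (h.r_pos hx).ne'
  refine ((h.hasDerivAt_greenDeriv hF hx).div (h.inc.hasDerivAt_deriv hx) h5).congr_deriv ?_
  rw [h.inc.deriv_deriv_eq (h.σ_pos x hx) hx]
  simp only [greenDeriv, greenFun, Qfun]
  field_simp
  linear_combination (∫ s in Ioc 0 x, F s * bigPsi b σ φ ψ s) * r x * h1

theorem ratio_coeff_pos (h : FundamentalPair b σ r φ ψ) (hx : 0 < x) :
    0 < 2 * r x * wronskianConst φ ψ * scaleDeriv b σ x / (σ x ^ 2 * deriv ψ x ^ 2) := by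
  have h2 := h.wronskianConst_pos
  have h3 := scaleDeriv_pos b σ x
  have h4 := h.σ_pos x hx
  have h5 := h.inc.deriv_pos x hx
  have h6 := h.r_pos hx
  positivity

theorem deriv_inc_div_pos (h : FundamentalPair b σ r φ ψ) (hx : 0 < x) :
    0 < deriv ψ x / (wronskianConst φ ψ * scaleDeriv b σ x) :=
  div_pos (h.inc.deriv_pos x hx) (mul_pos h.wronskianConst_pos (scaleDeriv_pos b σ x))

theorem deriv_dec_div_neg (h : FundamentalPair b σ r φ ψ) (hx : 0 < x) :
    deriv φ x / (wronskianConst φ ψ * scaleDeriv b σ x) < 0 :=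
  div_neg_of_neg_of_pos (h.dec.deriv_neg x hx)
    (mul_pos h.wronskianConst_pos (scaleDeriv_pos b σ x))

/-! ### Monotonicity and sign of `Q` -/

theorem mul_bigPsi_le (h : FundamentalPair b σ r φ ψ) {c : ℝ} (hx : 0 < x) (hc : F x / r x ≤ c) :
    F x * bigPsi b σ φ ψ x ≤ c * (r x * bigPsi b σ φ ψ x) := by
  rw [div_le_iff₀ (h.r_pos hx)] at hc
  rw [← mul_assoc]
  exact mul_le_mul_of_nonneg_right hc (h.bigPsi_pos hx).le

theorem le_mul_bigPsi (h : FundamentalPair b σ r φ ψ) {c : ℝ} (hx : 0 < x) (hc : c ≤ F x / r x) :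
    c * (r x * bigPsi b σ φ ψ x) ≤ F x * bigPsi b σ φ ψ x := by
  rw [le_div_iff₀ (h.r_pos hx)] at hc
  rw [← mul_assoc]
  exact mul_le_mul_of_nonneg_right hc (h.bigPsi_pos hx).le

theorem le_mul_bigPhi (h : FundamentalPair b σ r φ ψ) {c : ℝ} (hx : 0 < x) (hc : c ≤ F x / r x) :
    c * (r x * bigPhi b σ φ ψ x) ≤ F x * bigPhi b σ φ ψ x := by
  rw [le_div_iff₀ (h.r_pos hx)] at hc
  rw [← mul_assoc]
  exact mul_le_mul_of_nonneg_right hc (h.bigPhi_pos hx).le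

theorem integral_mul_bigPsi_le (h : FundamentalPair b σ r φ ψ) (hF : GreenIntegrable b σ φ ψ F)
    (hx : 0 < x) {c : ℝ} (hc : ∀ s, 0 < s → s ≤ x → F s / r s ≤ c) :
    ∫ s in Ioc 0 x, F s * bigPsi b σ φ ψ s
      ≤ c * (deriv ψ x / (wronskianConst φ ψ * scaleDeriv b σ x)) := by
  obtain ⟨hi, he⟩ := h.integrableOn_r_mul_bigPsi_and_integral hx
  rw [← he, ← integral_const_mul]
  exact setIntegral_mono_on (hF.left x hx) (hi.const_mul c) measurableSet_Ioc
    fun s hs => h.mul_bigPsi_le hs.1 (hc s hs.1 hs.2)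

theorem le_integral_mul_bigPsi (h : FundamentalPair b σ r φ ψ) (hF : GreenIntegrable b σ φ ψ F)
    (hx : 0 < x) {c : ℝ} (hc : ∀ s, 0 < s → s ≤ x → c ≤ F s / r s) :
    c * (deriv ψ x / (wronskianConst φ ψ * scaleDeriv b σ x))
      ≤ ∫ s in Ioc 0 x, F s * bigPsi b σ φ ψ s := by
  obtain ⟨hi, he⟩ := h.integrableOn_r_mul_bigPsi_and_integral hx
  rw [← he, ← integral_const_mul]
  exact setIntegral_mono_on (hi.const_mul c) (hF.left x hx) measurableSet_Ioc
    fun s hs => h.le_mul_bigPsi hs.1 (hc s hs.1 hs.2)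

/-- An integrated form of `Q' = -(F/r)' J` with `J = ψ'/(Cp')`: bounding `F/r` below by its value at
`y` gives `∫ₓʸ FΨ ≥ (F/r)(y)(J(y) - J(x))`. No differentiability of `F/r` is needed. -/
theorem Qfun_add_le (h : FundamentalPair b σ r φ ψ) (hF : GreenIntegrable b σ φ ψ F) {y : ℝ}
    (hx : 0 < x) (hxy : x ≤ y) (hc : ∀ s, x ≤ s → s ≤ y → F y / r y ≤ F s / r s) :
    Qfun b σ r φ ψ F x + (F x / r x - F y / r y) *
      (deriv ψ x / (wronskianConst φ ψ * scaleDeriv b σ x)) ≤ Qfun b σ r φ ψ F y := by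
  have := sub_le_sub_of_hasDerivAt hxy
    (fun s hs => (h.hasDerivAt_deriv_inc_div (hx.trans_le hs.1)).const_mul (F y / r y))
    (fun s hs => hasDerivAt_integral_Ioc (hF.continuousOn.mul h.continuousOn_bigPsi) hF.left
      (hx.trans_le hs.1))
    (fun s hs => h.le_mul_bigPsi (hx.trans_le hs.1) (hc s hs.1 hs.2))
  unfold Qfun
  simp only [Pi.mul_apply] at this
  linarith

/-- `Q(x)` is the integral of `(F/r(s) - F/r(x)) rΨ` over `]0, x]`. Splitting at `x / 2` yields
strictness: on the first half `F/r` stays below its smaller value at `x / 2`. -/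
theorem Qfun_neg_of_strictMonoOn (h : FundamentalPair b σ r φ ψ)
    (hF : GreenIntegrable b σ φ ψ F) (hx : 0 < x)
    (hm : StrictMonoOn (fun s => F s / r s) (Ioc 0 x)) : Qfun b σ r φ ψ F x < 0 := by
  have hx2 := half_pos hx
  have h1 := h.integral_mul_bigPsi_le hF hx2 (c := F (x / 2) / r (x / 2)) fun s hs hsx =>
    hm.monotoneOn ⟨hs, by linarith⟩ ⟨hx2, by linarith⟩ hsx
  have h2 := sub_le_sub_of_hasDerivAt (by linarith : x / 2 ≤ x)
    (fun s hs => hasDerivAt_integral_Ioc (hF.continuousOn.mul h.continuousOn_bigPsi) hF.left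
      (hx2.trans_le hs.1))
    (fun s hs => (h.hasDerivAt_deriv_inc_div (hx2.trans_le hs.1)).const_mul (F x / r x))
    (fun s hs => h.mul_bigPsi_le (hx2.trans_le hs.1)
      (hm.monotoneOn ⟨hx2.trans_le hs.1, hs.2⟩ ⟨hx, le_rfl⟩ hs.2))
  have h3 : F (x / 2) / r (x / 2) < F x / r x :=
    hm ⟨hx2, by linarith⟩ ⟨hx, le_rfl⟩ (by linarith)
  have h4 := mul_lt_mul_of_pos_right h3 (h.deriv_inc_div_pos hx2)
  simp only [Pi.mul_apply] at h2
  unfold Qfun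
  linarith

theorem strictMonoOn_Qfun (h : FundamentalPair b σ r φ ψ) (hF : GreenIntegrable b σ φ ψ F)
    (hx : 0 < x) (hm : StrictAntiOn (fun s => F s / r s) (Ici x)) :
    StrictMonoOn (Qfun b σ r φ ψ F) (Ici x) := by
  intro y hy z hz hyz
  have hy0 : 0 < y := hx.trans_le hy
  have h1 := h.Qfun_add_le hF hy0 hyz.le fun s hs hsz =>
    hm.antitoneOn (mem_Ici.2 (le_trans hy hs)) hz hsz
  have h2 : F z / r z < F y / r y := hm hy hz hyz
  have := mul_pos (sub_pos.2 h2) (h.deriv_inc_div_pos hy0)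
  linarith

theorem continuousOn_Qfun (h : FundamentalPair b σ r φ ψ) (hF : GreenIntegrable b σ φ ψ F) :
    ContinuousOn (Qfun b σ r φ ψ F) (Ioi 0) := by
  refine ContinuousOn.sub ?_ (ContinuousOn.mul ?_ ?_)
  · exact fun x hx => (hasDerivAt_integral_Ioc (hF.continuousOn.mul h.continuousOn_bigPsi) hF.left
      hx).continuousAt.continuousWithinAt
  · exact hF.continuousOn.div h.continuousOn_r fun x hx => (h.r_pos hx).ne'
  · exact fun x hx => (h.hasDerivAt_deriv_inc_div hx).continuousAt.continuousWithinAt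

/-- The sign change of `Q`. -/
theorem exists_sign_change_Qfun (h : FundamentalPair b σ r φ ψ) (hF : GreenIntegrable b σ φ ψ F)
    {ξ : ℝ} (hξ : 0 < ξ) (hinc : StrictMonoOn (fun s => F s / r s) (Ioc 0 ξ))
    (hdec : StrictAntiOn (fun s => F s / r s) (Ici ξ)) :
    ∃ xl : EReal, (ξ : EReal) < xl ∧
      (∀ x : ℝ, 0 < x → (x : EReal) < xl → Qfun b σ r φ ψ F x < 0) ∧
      (∀ x : ℝ, xl < (x : EReal) → 0 < Qfun b σ r φ ψ F x) ∧
      (xl < ⊤ ↔ ∃ y, ξ < y ∧ 0 < Qfun b σ r φ ψ F y) := by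
  have hmono := h.strictMonoOn_Qfun hF hξ hdec
  have hneg : ∀ x, 0 < x → x ≤ ξ → Qfun b σ r φ ψ F x < 0 := fun x hx hxξ =>
    h.Qfun_neg_of_strictMonoOn hF hx (hinc.mono (Ioc_subset_Ioc_right hxξ))
  by_cases hy : ∃ y, ξ < y ∧ 0 < Qfun b σ r φ ψ F y
  · obtain ⟨y, hξy, hQy⟩ := hy
    obtain ⟨x₀, hx₀, hQ⟩ := intermediate_value_Ioo hξy.le
      ((h.continuousOn_Qfun hF).mono fun s hs => hξ.trans_le hs.1) ⟨hneg ξ hξ le_rfl, hQy⟩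
    refine ⟨x₀, EReal.coe_lt_coe_iff.2 hx₀.1, fun x hx hxx => ?_, fun x hxx => ?_,
      fun _ => ⟨y, hξy, hQy⟩, fun _ => EReal.coe_lt_top _⟩
    · rcases le_total x ξ with hxξ | hxξ
      · exact hneg x hx hxξ
      · rw [← hQ]
        exact hmono hxξ hx₀.1.le (EReal.coe_lt_coe_iff.1 hxx)
    · rw [← hQ]
      exact hmono hx₀.1.le (hx₀.1.trans (EReal.coe_lt_coe_iff.1 hxx)).le
        (EReal.coe_lt_coe_iff.1 hxx)
  · refine ⟨⊤, EReal.coe_lt_top _, fun x hx _ => ?_, fun x hx => absurd hx not_top_lt,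
      fun ht => absurd ht (lt_irrefl _), fun hy' => absurd hy' hy⟩
    push Not at hy
    rcases le_total x ξ with hxξ | hxξ
    · exact hneg x hx hxξ
    · have h1 : Qfun b σ r φ ψ F x < Qfun b σ r φ ψ F (x + 1) :=
        hmono hxξ (mem_Ici.2 (by linarith)) (by linarith)
      exact h1.trans_le (hy (x + 1) (by linarith))

theorem exists_Qfun_pos (h : FundamentalPair b σ r φ ψ) (hF : GreenIntegrable b σ φ ψ F)
    {ξ : ℝ} (hξ : 0 < ξ) (hinc : StrictMonoOn (fun s => F s / r s) (Ioc 0 ξ))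
    (hdec : StrictAntiOn (fun s => F s / r s) (Ici ξ)) {ℓ₀ ℓ : EReal}
    (hℓ₀ : Tendsto (fun x => ((F x / r x : ℝ) : EReal)) (𝓝[>] 0) (𝓝 ℓ₀))
    (hℓ : Tendsto (fun x => ((F x / r x : ℝ) : EReal)) atTop (𝓝 ℓ)) (hlt : ℓ = ⊥ ∨ ℓ < ℓ₀) :
    ∃ y, ξ < y ∧ 0 < Qfun b σ r φ ψ F y := by
  rcases hlt with rfl | hlt
  · rw [EReal.tendsto_coe_nhds_bot_iff] at hℓ
    have hJ := h.deriv_inc_div_pos hξ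
    -- The threshold is the value of `F/r` at `y` at which the lower bound for `Q(y)` from
    -- `Qfun_add_le`, started at `ξ`, becomes zero.
    obtain ⟨y, hξy, hy⟩ := ((eventually_gt_atTop ξ).and (hℓ.eventually_lt_atBot
      (F ξ / r ξ + Qfun b σ r φ ψ F ξ /
        (deriv ψ ξ / (wronskianConst φ ψ * scaleDeriv b σ ξ))))).exists
    refine ⟨y, hξy, ?_⟩
    have h1 := h.Qfun_add_le hF hξ hξy.le fun s hs hsy =>
      hdec.antitoneOn (mem_Ici.2 hs) (mem_Ici.2 hξy.le) hsy
    have h2 : -(Qfun b σ r φ ψ F ξ / (deriv ψ ξ / (wronskianConst φ ψ * scaleDeriv b σ ξ)))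
        < F ξ / r ξ - F y / r y := by linarith
    rw [← neg_div, div_lt_iff₀ hJ] at h2
    linarith
  · obtain ⟨c, hc1, hc2⟩ := EReal.lt_iff_exists_real_btwn.1 hlt
    obtain ⟨y, hξy, hy⟩ := ((eventually_gt_atTop ξ).and (hℓ.eventually_lt_const hc1)).exists
    have hyc : F y / r y < c := EReal.coe_lt_coe_iff.1 hy
    -- Left of `ξ` the ratio is at least its limit at `0`, which exceeds `c`; right of `ξ` it
    -- decreases. Hence its minimum over `]0, y]` is attained at `y`, and `Q(y) ≥ 0`.
    have hle : ∀ s, 0 < s → s ≤ y → F y / r y ≤ F s / r s := by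
      intro s hs hsy
      rcases le_total s ξ with hsξ | hsξ
      · refine hyc.le.trans (EReal.coe_le_coe_iff.1 (hc2.le.trans (le_of_tendsto hℓ₀ ?_)))
        filter_upwards [Ioo_mem_nhdsGT hs] with w hw
        exact EReal.coe_le_coe_iff.2 (hinc.monotoneOn ⟨hw.1, hw.2.le.trans hsξ⟩ ⟨hs, hsξ⟩ hw.2.le)
      · exact hdec.antitoneOn hsξ (mem_Ici.2 hξy.le) hsy
    have h1 : 0 ≤ Qfun b σ r φ ψ F y := by
      have := h.le_integral_mul_bigPsi hF (hξ.trans hξy) hle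
      unfold Qfun
      linarith
    -- Only `Q(y) ≥ 0` is known, so one further step of strict increase is taken.
    refine ⟨y + 1, by linarith, h1.trans_lt ?_⟩
    exact h.strictMonoOn_Qfun hF hξ hdec hξy.le (mem_Ici.2 (by linarith)) (by linarith)

/-- `R_F / ψ` vanishes at infinity. -/
theorem tendsto_greenFun_div_inc (h : FundamentalPair b σ r φ ψ) (hF : GreenIntegrable b σ φ ψ F) :
    Tendsto (fun x => greenFun b σ φ ψ F x / ψ x) atTop (𝓝 0) := by
  have hratio : Tendsto (fun x => φ x / ψ x) atTop (𝓝 0) := by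
    refine squeeze_zero' ?_ ?_ (h.tendsto_inc_atTop.const_div_atTop (φ 1))
    · filter_upwards [eventually_gt_atTop 0] with x hx
      exact (div_pos (h.dec.pos x hx) (h.inc.pos x hx)).le
    · filter_upwards [eventually_ge_atTop 1] with x hx
      have hx0 := one_pos.trans_le hx
      exact div_le_div_of_nonneg_right (h.strictAntiOn_dec.antitoneOn (mem_Ioi.2 one_pos)
        (mem_Ioi.2 hx0) hx) (h.inc.pos x hx0).le
  have htail : ∀ f : ℝ → ℝ, (∀ x, 0 < x → IntegrableOn f (Ioi x)) →
      Tendsto (fun x => ∫ s in Ioi x, f s) atTop (𝓝 0) := by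
    intro f hf
    have h1 := (intervalIntegral_tendsto_integral_Ioi 1 (hf 1 one_pos) tendsto_id).const_sub
      (∫ s in Ioi 1, f s)
    rw [sub_self] at h1
    refine h1.congr' ?_
    filter_upwards [eventually_gt_atTop 0] with x hx
    exact (integral_Ioi_eq_sub hf one_pos hx).symm
  have hB := htail _ hF.right
  have hT := htail (fun s => ‖F s * bigPhi b σ φ ψ s‖) fun x hx => (hF.right x hx).norm
  -- The integral is split at a large `N`. The part up to `N` is fixed and multiplied by `φ/ψ → 0`.
  -- Beyond `N`, since `φ/ψ` decreases, `(φ/ψ)(x) Ψ(s) ≤ (φ/ψ)(s) Ψ(s) = Φ(s)`, so the rest is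
  -- bounded by a tail of `∫ |F|Φ`.
  have hA : Tendsto (fun x => φ x / ψ x * ∫ s in Ioc 0 x, F s * bigPsi b σ φ ψ s) atTop (𝓝 0) := by
    rw [Metric.tendsto_nhds]
    intro ε hε
    obtain ⟨N, hN0, hN⟩ := ((eventually_gt_atTop 0).and
      (hT.eventually_lt_const (half_pos hε))).exists
    have h2 := (hratio.mul_const |∫ s in Ioc 0 N, F s * bigPsi b σ φ ψ s|)
    rw [zero_mul] at h2
    filter_upwards [eventually_ge_atTop N, h2.eventually_lt_const (half_pos hε)] with x hxN hx2
    have hx0 := hN0.trans_le hxN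
    have hq : 0 < φ x / ψ x := div_pos (h.dec.pos x hx0) (h.inc.pos x hx0)
    have h3 : ‖∫ s in N..x, φ x / ψ x * (F s * bigPsi b σ φ ψ s)‖
        ≤ ∫ s in Ioi N, ‖F s * bigPhi b σ φ ψ s‖ := by
      rw [intervalIntegral.integral_of_le hxN]
      refine (norm_integral_le_of_norm_le
        (IntegrableOn.mono_set (hF.right N hN0).norm Ioc_subset_Ioi_self) ?_).trans (setIntegral_mono_set (hF.right N hN0).norm
          (Eventually.of_forall fun s => norm_nonneg _) Ioc_subset_Ioi_self.eventuallyLE)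
      filter_upwards [ae_restrict_mem measurableSet_Ioc] with s hs
      have hs0 : 0 < s := hN0.trans hs.1
      have e1 := dec_mul_bigPsi (b := b) (σ := σ) (φ := φ) (ψ := ψ) s
      have e2 : φ x / ψ x ≤ φ s / ψ s := div_le_div₀ (h.dec.pos s hs0).le
        (h.strictAntiOn_dec.antitoneOn (mem_Ioi.2 hs0) (mem_Ioi.2 hx0) hs.2) (h.inc.pos s hs0)
        (h.strictMonoOn_inc.monotoneOn (mem_Ioi.2 hs0) (mem_Ioi.2 hx0) hs.2)
      have e3 : bigPhi b σ φ ψ s = φ s / ψ s * bigPsi b σ φ ψ s := by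
        have := (h.inc.pos s hs0).ne'
        field_simp
        linarith
      rw [norm_mul, norm_mul, norm_mul, e3, norm_mul, Real.norm_of_nonneg hq.le,
        Real.norm_of_nonneg (hq.le.trans e2)]
      have := mul_le_mul_of_nonneg_right e2 (mul_nonneg (norm_nonneg (F s))
        (norm_nonneg (bigPsi b σ φ ψ s)))
      linarith
    rw [dist_zero_right, integral_Ioc_eq_add hF.left hN0 hx0, mul_add,
      ← intervalIntegral.integral_const_mul]
    refine (norm_add_le _ _).trans_lt ?_
    rw [norm_mul, Real.norm_of_nonneg hq.le, Real.norm_eq_abs (∫ s in Ioc 0 N, _)]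
    linarith
  have := hA.add hB
  rw [add_zero] at this
  refine this.congr' ?_
  filter_upwards [eventually_gt_atTop 0] with x hx
  have := (h.inc.pos x hx).ne'
  unfold greenFun
  field_simp

/-- For `c = F(x)/r(x)`, `F ≤ c r` on `]0, x]` is weighted by the negative `φ'/ψ'`, while `F ≥ c r`
on `[x, ξ]` is weighted by `Φ > 0`. Both give lower bounds, and the values of `φ'/(Cp')` at `x`
cancel. The coefficient of `c` is thus a fixed negative number, so the bound explodes when `F/r →
-∞` at `0`. -/
theorem le_greenDeriv_div (h : FundamentalPair b σ r φ ψ) (hF : GreenIntegrable b σ φ ψ F)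
    {ξ : ℝ} (hinc : StrictMonoOn (fun s => F s / r s) (Ioc 0 ξ)) (hx : 0 < x) (hxξ : x ≤ ξ) :
    F x / r x * (deriv φ ξ / (wronskianConst φ ψ * scaleDeriv b σ ξ))
      + ∫ s in Ioi ξ, F s * bigPhi b σ φ ψ s ≤ greenDeriv b σ φ ψ F x / deriv ψ x := by
  have h1 := h.integral_mul_bigPsi_le hF hx (c := F x / r x) fun s hs hsx =>
    hinc.monotoneOn ⟨hs, hsx.trans hxξ⟩ ⟨hx, hxξ⟩ hsx
  have h2 := sub_le_sub_of_hasDerivAt hxξ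
    (fun s hs => (h.hasDerivAt_deriv_dec_div (hx.trans_le hs.1)).const_mul (F x / r x))
    (fun s hs => (hasDerivAt_integral_Ioi (hF.continuousOn.mul h.continuousOn_bigPhi) hF.right
      (hx.trans_le hs.1)).fun_neg)
    (fun s hs => by
      rw [neg_neg]
      exact h.le_mul_bigPhi (hx.trans_le hs.1)
        (hinc.monotoneOn ⟨hx, hxξ⟩ ⟨hx.trans_le hs.1, hs.2⟩ hs.1))
  have hψ' := h.inc.deriv_pos x hx
  have h3 := mul_le_mul_of_nonpos_left h1 (div_neg_of_neg_of_pos (h.dec.deriv_neg x hx) hψ').le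
  have e1 : deriv φ x / deriv ψ x *
      (F x / r x * (deriv ψ x / (wronskianConst φ ψ * scaleDeriv b σ x)))
      = F x / r x * (deriv φ x / (wronskianConst φ ψ * scaleDeriv b σ x)) := by
    field_simp
  have e2 : greenDeriv b σ φ ψ F x / deriv ψ x = deriv φ x / deriv ψ x *
      (∫ s in Ioc 0 x, F s * bigPsi b σ φ ψ s) + ∫ s in Ioi x, F s * bigPhi b σ φ ψ s := by
    unfold greenDeriv
    field_simp
  rw [e1] at h3
  rw [e2]
  simp only [Pi.mul_apply] at h2
  linarith

theorem tendsto_greenDeriv_div_zero (h : FundamentalPair b σ r φ ψ)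
    (hF : GreenIntegrable b σ φ ψ F) {ξ : ℝ} (hξ : 0 < ξ)
    (hinc : StrictMonoOn (fun s => F s / r s) (Ioc 0 ξ))
    (hbot : Tendsto (fun x => F x / r x) (𝓝[>] 0) atBot) :
    Tendsto (fun x => greenDeriv b σ φ ψ F x / deriv ψ x) (𝓝[>] 0) atTop := by
  refine tendsto_atTop_mono' _ ?_ (tendsto_atTop_add_const_right _
    (∫ s in Ioi ξ, F s * bigPhi b σ φ ψ s)
    (hbot.atBot_mul_const_of_neg (h.deriv_dec_div_neg hξ)))
  filter_upwards [Ioo_mem_nhdsGT hξ] with x hx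
  exact h.le_greenDeriv_div hF hinc hx.1 hx.2.le

end FundamentalPair

end LinearDiffusion
-- The main theorem
theorem mainTheorem4
    {Ω : Type*} [mΩ : MeasurableSpace Ω] (P : Measure Ω) [IsProbabilityMeasure P]
    (ℱ : Filtration ℝ≥0 mΩ) (X : ℝ → ℝ≥0 → Ω → ℝ)
    (b σ r φ ψ Θ : ℝ → ℝ) (ξ : ℝ)
    (hb : LocallyLipschitzOn (Ici 0) b) (hσ : LocallyLipschitzOn (Ici 0) σ)
    (hσpos : ∀ x, 0 < x → 0 < σ x)
    (hr : ContinuousOn r (Ici 0)) (hrbdd : ∃ M, ∀ x, 0 ≤ x → r x ≤ M)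
    (hrpos : ∃ r₀, 0 < r₀ ∧ ∀ x, 0 ≤ x → r₀ ≤ r x)
    (hzero : LinearDiffusion.ZeroInaccessible b σ)
    (hinfty : LinearDiffusion.InftyInaccessible b σ)
    (hX : ∀ x, 0 < x → LinearDiffusion.IsDiffusion b σ P ℱ x (X x))
    (hφ : LinearDiffusion.IsDecreasingSolution b σ r φ)
    (hψ : LinearDiffusion.IsIncreasingSolution b σ r ψ)
    (hΘ : ContinuousOn Θ (Ioi 0)) (hξ : 0 < ξ)
    (hΘinc : StrictMonoOn (fun x => Θ x / r x) (Ioo 0 ξ))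
    (hΘdec : StrictAntiOn (fun x => Θ x / r x) (Ioi ξ))
    (hΘint : ∀ x, 0 < x → LinearDiffusion.FiniteDiscountedIntegral r P (X x) Θ) :
    -- the objects below are well defined
    DifferentiableOn ℝ (LinearDiffusion.resolvent r P X Θ) (Ioi 0) ∧
    DifferentiableOn ℝ (LinearDiffusion.derivRatio r P X ψ Θ) (Ioi 0) ∧
    (∀ x, 0 < x →
      IntegrableOn (fun s => Θ s * LinearDiffusion.bigPsi b σ φ ψ s) (Ioc 0 x)) ∧
    ∃ xl : EReal,
      -- (i)
      LinearDiffusion.IsTurningPoint ξ (LinearDiffusion.derivRatio r P X ψ Θ) xl ∧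
      (∀ y : EReal,
        LinearDiffusion.IsTurningPoint ξ (LinearDiffusion.derivRatio r P X ψ Θ) y → y = xl) ∧
      Tendsto (LinearDiffusion.derivRatio r P X ψ Θ) atTop (𝓝 0) ∧
      -- (ii)
      (∃ q : EReal,
        Tendsto (fun x => (LinearDiffusion.Qfun b σ r φ ψ Θ x : EReal)) atTop (𝓝 q) ∧
        (xl < ⊤ ↔ 0 < q)) ∧
      ∃ ℓ₀ ℓ : EReal,
        Tendsto (fun x => ((Θ x / r x : ℝ) : EReal)) (𝓝[>] 0) (𝓝 ℓ₀) ∧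
        Tendsto (fun x => ((Θ x / r x : ℝ) : EReal)) atTop (𝓝 ℓ) ∧
        (ℓ = ⊥ ∨ ℓ < ℓ₀ → xl < ⊤) ∧
        -- (iii)
        (xl < ⊤ →
          ∃ L : EReal,
            Tendsto (fun x => (LinearDiffusion.derivRatio r P X ψ Θ x : EReal)) (𝓝[>] 0) (𝓝 L) ∧
            xl < LinearDiffusion.upperPoint (LinearDiffusion.derivRatio r P X ψ Θ) L ∧
            (LinearDiffusion.upperPoint (LinearDiffusion.derivRatio r P X ψ Θ) L = ⊤ ↔ 0 ≤ L) ∧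
            (ℓ₀ = ⊥ → L = ⊤) ∧
            (L = ⊤ →
              LinearDiffusion.upperPoint (LinearDiffusion.derivRatio r P X ψ Θ) L = ⊤)) := by
  obtain ⟨K, hK⟩ := hrbdd
  obtain ⟨r₀, hr0, hr₀⟩ := hrpos
  have h : LinearDiffusion.FundamentalPair b σ r φ ψ :=
    ⟨hb.continuousOn.mono Ioi_subset_Ici_self, hσ.continuousOn.mono Ioi_subset_Ici_self, hσpos,
      hr.mono Ioi_subset_Ici_self, ⟨r₀, hr0, fun x hx => hr₀ x hx.le⟩, hzero, hinfty, hφ, hψ⟩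
  have hK' : ∀ y, 0 < y → r y ≤ K := fun y hy => hK y hy.le
  have hG := h.greenIntegrable_of_finiteDiscountedIntegral hK' hX hΘ hΘint
  have hR : ∀ x, 0 < x →
      HasDerivAt (LinearDiffusion.resolvent r P X Θ) (LinearDiffusion.greenDeriv b σ φ ψ Θ x) x := by
    intro x hx
    refine (h.hasDerivAt_greenFun hG hx).congr_of_eventuallyEq ?_
    filter_upwards [Ioi_mem_nhds hx] with y hy
    exact h.resolvent_eq_greenFun hK' hX hΘ hΘint hy
  have hratio : ∀ x, 0 < x → LinearDiffusion.derivRatio r P X ψ Θ x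
      = LinearDiffusion.greenDeriv b σ φ ψ Θ x / deriv ψ x := fun x hx => by
    rw [LinearDiffusion.derivRatio, (hR x hx).deriv]
  have hD := fun x (hx : 0 < x) => (h.hasDerivAt_greenDeriv_div hG hx).congr_of_eventuallyEq
    (f₁ := LinearDiffusion.derivRatio r P X ψ Θ) (by
      filter_upwards [Ioi_mem_nhds hx] with y hy
      exact hratio y hy)
  set g := LinearDiffusion.derivRatio r P X ψ Θ with hg
  -- Continuity at `ξ` extends both strict monotonicities to the closed end point, as the sign
  -- analysis of `Q` requires.
  have hcontθ : ContinuousAt (fun x => Θ x / r x) ξ :=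
    (hΘ.continuousAt (Ioi_mem_nhds hξ)).div (h.continuousOn_r.continuousAt (Ioi_mem_nhds hξ))
      (h.r_pos hξ).ne'
  have hinc := LinearDiffusion.strictMonoOn_Ioc_of_continuousAt hΘinc hcontθ
  have hdec := LinearDiffusion.strictAntiOn_Ici_of_continuousAt hΘdec hcontθ
  obtain ⟨xl, hξl, hneg, hpos, hiff⟩ := h.exists_sign_change_Qfun hG hξ hinc hdec
  have hturn : LinearDiffusion.IsTurningPoint ξ g xl := by
    refine ⟨hξl, fun x hx hxl => ?_, fun x hx => ?_⟩
    · rw [(hD x hx).deriv]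
      exact mul_neg_of_pos_of_neg (h.ratio_coeff_pos hx) (hneg x hx hxl)
    · have hx0 : 0 < x := hξ.trans (EReal.coe_lt_coe_iff.1 (hξl.trans hx))
      rw [(hD x hx0).deriv]
      exact mul_pos (h.ratio_coeff_pos hx0) (hpos x hx)
  have hanti : ∀ a : ℝ, (a : EReal) ≤ xl → StrictAntiOn g (Ioc 0 a) := fun a ha =>
    LinearDiffusion.strictAntiOn_of_hasDerivAt_neg (convex_Ioc 0 a) (fun x hx => hD x hx.1)
      fun x hx => by
        rw [interior_Ioc] at hx
        exact mul_neg_of_pos_of_neg (h.ratio_coeff_pos hx.1)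
          (hneg x hx.1 ((EReal.coe_lt_coe_iff.2 hx.2).trans_le ha))
  have hmono : ∀ a : ℝ, 0 < a → xl ≤ (a : EReal) → StrictMonoOn g (Ici a) := fun a ha0 ha =>
    LinearDiffusion.strictMonoOn_of_hasDerivAt_pos (convex_Ici a)
      (fun x hx => hD x (ha0.trans_le hx)) fun x hx => by
        rw [interior_Ici] at hx
        exact mul_pos (h.ratio_coeff_pos (ha0.trans hx))
          (hpos x (ha.trans_lt (EReal.coe_lt_coe_iff.2 hx)))
  have hlimR : Tendsto (fun x => LinearDiffusion.resolvent r P X Θ x / ψ x) atTop (𝓝 0) := by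
    refine (h.tendsto_greenFun_div_inc hG).congr' ?_
    filter_upwards [eventually_gt_atTop 0] with x hx
    rw [h.resolvent_eq_greenFun hK' hX hΘ hΘint hx]
  have hR' : ∀ x, 0 < x → HasDerivAt (LinearDiffusion.resolvent r P X Θ) (g x * deriv ψ x) x := by
    intro x hx
    rw [hratio x hx, div_mul_cancel₀ _ (hψ.deriv_pos x hx).ne']
    exact hR x hx
  -- The ratio is monotone near `∞` in either case: increasing beyond a finite turning point,
  -- decreasing throughout if there is none.
  have hlim : Tendsto g atTop (𝓝 0) := by
    induction xl with
    | bot => exact absurd hξl not_lt_bot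
    | coe x₀ =>
      have hx₀ : 0 < x₀ := hξ.trans (EReal.coe_lt_coe_iff.1 hξl)
      exact LinearDiffusion.tendsto_zero_of_monotoneOn_ratio
        (fun x hx => hψ.hasDerivAt (hx₀.trans_le hx))
        (fun x hx => (hψ.deriv_pos x (hx₀.trans_le hx)).le) h.tendsto_inc_atTop
        (fun x hx => hR' x (hx₀.trans_le hx)) hlimR (hmono x₀ hx₀ le_rfl).monotoneOn
    | top =>
      refine LinearDiffusion.tendsto_zero_of_antitoneOn_ratio (a := 1)
        (fun x hx => hψ.hasDerivAt (one_pos.trans_le hx))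
        (fun x hx => (hψ.deriv_pos x (one_pos.trans_le hx)).le) h.tendsto_inc_atTop
        (fun x hx => hR' x (one_pos.trans_le hx)) hlimR fun x hx y hy hxy => ?_
      exact (hanti y le_top).antitoneOn ⟨one_pos.trans_le hx, hxy⟩ ⟨one_pos.trans_le hy, le_rfl⟩ hxy
  have hQmono := h.strictMonoOn_Qfun hG hξ hdec
  obtain ⟨q, hq⟩ := LinearDiffusion.exists_tendsto_atTop_of_monotoneOn hQmono.monotoneOn
  obtain ⟨ℓ₀, hℓ₀⟩ := LinearDiffusion.exists_tendsto_zero_of_monotoneOn hξ hΘinc.monotoneOn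
  obtain ⟨ℓ, hℓ⟩ := LinearDiffusion.exists_tendsto_atTop_of_antitoneOn hdec.antitoneOn
  refine ⟨fun x hx => (hR x hx).differentiableAt.differentiableWithinAt,
    fun x hx => (hD x hx).differentiableAt.differentiableWithinAt, hG.left, xl, hturn,
    fun y hy => hy.unique hξ hturn, hlim, ⟨q, hq, ?_⟩, ℓ₀, ℓ, hℓ₀, hℓ,
    fun hlt => hiff.2 (h.exists_Qfun_pos hG hξ hinc hdec hℓ₀ hℓ hlt), fun htop => ?_⟩
  · rw [hiff]
    -- A finite turning point means that `Q` is positive somewhere beyond `ξ`; as `Q` increases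
    -- there, this is the same as a positive limit.
    constructor
    · rintro ⟨y, hξy, hy⟩
      refine (EReal.coe_lt_coe_iff.2 hy).trans_le (ge_of_tendsto hq ?_)
      filter_upwards [eventually_ge_atTop y] with z hz
      exact EReal.coe_le_coe_iff.2 (hQmono.monotoneOn hξy.le (hξy.le.trans hz) hz)
    · intro hq0
      obtain ⟨y, hξy, hy⟩ :=
        ((eventually_gt_atTop ξ).and (hq.eventually_const_lt hq0)).exists
      exact ⟨y, hξy, EReal.coe_lt_coe_iff.1 hy⟩
  · induction xl with
    | bot => exact absurd hξl not_lt_bot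
    | top => exact absurd htop (lt_irrefl _)
    | coe x₀ =>
      have hx₀ : 0 < x₀ := hξ.trans (EReal.coe_lt_coe_iff.1 hξl)
      obtain ⟨L, hL, hup, hupiff⟩ := LinearDiffusion.exists_limit_and_upperPoint hx₀
        (hanti x₀ le_rfl) (hmono x₀ hx₀ le_rfl) (hD x₀ hx₀).continuousAt hlim
      refine ⟨L, hL, hup, hupiff, fun hbot => ?_, fun hLtop => hupiff.2 (hLtop ▸ le_top)⟩
      rw [hbot, EReal.tendsto_coe_nhds_bot_iff] at hℓ₀
      have h1 : Tendsto g (𝓝[>] 0) atTop := by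
        refine (h.tendsto_greenDeriv_div_zero hG hξ hinc hℓ₀).congr' ?_
        filter_upwards [self_mem_nhdsWithin] with x hx
        exact (hratio x hx).symm
      exact tendsto_nhds_unique hL (EReal.tendsto_coe_nhds_top_iff.2 h1)
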